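/- Let $d\ge 2$ be an integer and let $0<s\le 1$, $1<\gamma<\infty$, $1\le p,q<\infty$, $1<\alpha<d$ and $0<\beta_1,\beta_2<\infty$ be real numbers such that $$\beta_1p+2\beta_2q=1,\qquad (d-sp)\beta_1+(d+\alpha)\beta_2=\frac d\gamma,\qquad \mathcal D:=p(d+\alpha)-2q(d-sp)\neq 0 .$$ Let $C^1_{c,\mathrm{rad}}(\mathbb R^d)$ be the space of radial, continuously differentiable, compactly supported real-valued functions on $\mathbb R^d$, and put $$\|g\|_{\dot W^{s,p}(\mathbb R^d)}=\left(\int_{\mathbb R^d}\int_{\mathbb R^d}\frac{|g(x)-g(y)|^p}{|x-y|^{d+sp}}\,dx\,dy\right)^{1/p}\ \text{ if } 0<s<1,\qquad \|g\|_{\dot W^{1,p}(\mathbb R^d)}=\left(\int_{\mathbb R^d}|\nabla g(x)|^p\,dx\right)^{1/p}.$$ Assume that either $$\beta_1\gamma+\frac{d+\alpha-2}{d-1}\,\beta_2\gamma<1,$$ or $$\beta_1\gamma+\frac{d+\alpha-2}{d-1}\,\beta_2\gamma=1\quad\text{and}\quad q(1-sp)\neq p .$$ Then there is no finite constant $C$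 such that $$\|g\|_{L^\gamma(\mathbb R^d)}\le C\,\|g\|_{\dot W^{s,p}(\mathbb R^d)}^{\beta_1p}\left(\int_{\mathbb R^d}\int_{\mathbb R^d}\frac{|g(x)|^q|g(y)|^q}{|x-y|^{d-\alpha}}\,dx\,dy\right)^{\beta_2}\qquad\text{for all } g\in C^1_{c,\mathrm{rad}}(\mathbb R^d).$$ -/

import Mathlib

open MeasureTheory
open scoped ENNReal NNReal

noncomputable section

/-- The space of radial, continuously differentiable, compactly supported (real-valued) functions
on `ℝ^d` with its Euclidean norm. -/
def C1cRad (d : ℕ) : Set (EuclideanSpace ℝ (Fin d) → ℝ) :=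
  {g | ContDiff ℝ 1 g ∧ HasCompactSupport g ∧ ∀ x y, ‖x‖ = ‖y‖ → g x = g y}

/-- The homogeneous Sobolev seminorm on `ℝ^d`, with values in `[0, ∞]`: the Gagliardo seminorm for
`0 < s < 1`, the `L^p` norm of the gradient for `s = 1` (the norm of the Fréchet derivative is the
norm of the gradient), and the `L^p` norm for `s = 0`. -/
def sobolevSeminorm {d : ℕ} (s p : ℝ) (g : EuclideanSpace ℝ (Fin d) → ℝ) : ℝ≥0∞ :=
  if s = 0 then (∫⁻ x, ‖g x‖ₑ ^ p) ^ (1 / p)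
  else if s = 1 then (∫⁻ x, ‖fderiv ℝ g x‖ₑ ^ p) ^ (1 / p)
  else (∫⁻ x, ∫⁻ y, ‖g x - g y‖ₑ ^ p / ‖x - y‖ₑ ^ ((d : ℝ) + s * p)) ^ (1 / p)

/-- The Coulomb energy `∫∫ |g(x)|^q |g(y)|^q / |x - y|^(d - α) dx dy`, with values in `[0, ∞]`. -/
def coulombEnergy {d : ℕ} (α q : ℝ) (g : EuclideanSpace ℝ (Fin d) → ℝ) : ℝ≥0∞ :=
  ∫⁻ x, ∫⁻ y, ‖g x‖ₑ ^ q * ‖g y‖ₑ ^ q / ‖x - y‖ₑ ^ ((d : ℝ) - α)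

end

/-! The inequality is tested on superpositions of radial bumps of height `a k`, each living on a
thin spherical shell of radius `R k` and width `w k`. Put `n = d - 1` and `e = d - α`. Up to
constants independent of the number of shells, `∫ |g|^γ` is at least `∑ a^γ w R^n`, the `p`-th power
of the Sobolev seminorm is at most `∑ a^p w^(1 - s p) R^n`, and the energy is at most the double sum
of `a_k^q w_k R_k^n a_l^q w_l R_l^n max(R_k, R_l)^(-e)`. The self-energy of a thin shell has this
size because `α > 1`, that is `e < n`: the Riesz kernel is then integrable on hypersurfaces.
`exists_shellSum_inequality` reduces the claim to an inequality between these sums.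

If the condition on the exponents is strict, one shell with `a = w = 1` and `R → ∞` violates it: the
left side grows like `R^(n/γ)`, the right side like a smaller power.

In the case of equality, take `a = R^x` and `w = R^y`, with `x, y` chosen so that every shell
contributes exactly `1` to the Sobolev sum and `1` to the diagonal of the energy; this linear system
is solvable because `q(1 - sp) ≠ p`. The relations between the exponents then force each
contribution to the `L^γ` sum to be `1` as well. Since `𝒟 ≠ 0`, `y ≠ 1`, so shells become relatively
thin either as `R → ∞` or as `R → 0`. Placing `N` shells at very sparse radii makes the interactions
negligible, and the inequality would give `N^(1/γ) ≤ C' N^(β₁ + β₂)` for all `N`, although `β₁ + β₂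
< 1/γ`. -/

/-! ### Integrals of power kernels and their scaling. -/

theorem setLIntegral_ball_enorm_rpow_neg_lt_top {E : Type*} [NormedAddCommGroup E]
    [NormedSpace ℝ E] [FiniteDimensional ℝ E] [MeasurableSpace E] [BorelSpace E]
    (μ : Measure E) [μ.IsAddHaarMeasure] (hE : 1 ≤ Module.finrank ℝ E) {e : ℝ}
    (he : e < Module.finrank ℝ E) (r : ℝ) :
    ∫⁻ z in Metric.ball (0 : E) r, ‖z‖ₑ ^ (-e) ∂μ < ⊤ := by
  have : Nontrivial E := Module.nontrivial_of_finrank_pos (R := ℝ) (by omega)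
  have h : IntegrableOn (fun z : E => ‖z‖ ^ (-e)) (Metric.ball 0 r) μ :=
    integrableOn_ball_of_norm_le_rpow (C := 1) hE he
      (Filter.Eventually.of_forall fun x => by
        rw [one_mul, Real.norm_of_nonneg (by positivity)])
      (Measurable.aestronglyMeasurable (by fun_prop))
  refine lt_of_le_of_lt (le_of_eq ?_) h.hasFiniteIntegral
  refine lintegral_congr_ae (ae_restrict_of_ae ?_)
  filter_upwards [Measure.ae_ne μ 0] with z hz
  have hz' : 0 < ‖z‖ := norm_pos_iff.2 hz
  rw [Real.enorm_of_nonneg (by positivity), ← ENNReal.ofReal_rpow_of_pos hz', ofReal_norm]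

theorem setLIntegral_ball_compl_enorm_rpow_neg_lt_top {E : Type*} [NormedAddCommGroup E]
    [NormedSpace ℝ E] [FiniteDimensional ℝ E] [MeasurableSpace E] [BorelSpace E]
    (μ : Measure E) [μ.IsAddHaarMeasure] {e : ℝ} (he : Module.finrank ℝ E < e) :
    ∫⁻ z in (Metric.ball (0 : E) 1)ᶜ, ‖z‖ₑ ^ (-e) ∂μ < ⊤ := by
  have he0 : 0 < e := lt_of_le_of_lt (Nat.cast_nonneg _) he
  have h : Integrable (fun z : E => (2 : ℝ) ^ e * (1 + ‖z‖) ^ (-e)) μ :=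
    (integrable_one_add_norm he).const_mul _
  refine lt_of_le_of_lt ?_ h.hasFiniteIntegral
  refine (setLIntegral_mono' Metric.isOpen_ball.measurableSet.compl fun z hz => ?_).trans
    (setLIntegral_le_lintegral _ _)
  have hz' : 1 ≤ ‖z‖ := by simpa using hz
  have hz0 : 0 < ‖z‖ := by linarith
  rw [Real.enorm_of_nonneg (by positivity), ← ofReal_norm, ENNReal.ofReal_rpow_of_pos hz0]
  refine ENNReal.ofReal_le_ofReal ?_
  have h2 : (2 * ‖z‖) ^ (-e) ≤ (1 + ‖z‖) ^ (-e) :=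
    Real.rpow_le_rpow_of_nonpos (by linarith) (by linarith) (by linarith)
  rw [Real.mul_rpow (by norm_num) hz0.le] at h2
  calc ‖z‖ ^ (-e) = 2 ^ e * (2 ^ (-e) * ‖z‖ ^ (-e)) := by
        rw [← mul_assoc, ← Real.rpow_add (by norm_num)]; simp
    _ ≤ _ := by exact mul_le_mul_of_nonneg_left h2 (by positivity)

theorem lintegral_comp_smul_of_pos {E : Type*} [NormedAddCommGroup E]
    [NormedSpace ℝ E] [FiniteDimensional ℝ E] [MeasurableSpace E] [BorelSpace E]
    (μ : Measure E) [μ.IsAddHaarMeasure] {f : E → ℝ≥0∞} (hf : Measurable f) {r : ℝ} (hr : 0 < r) :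
    ∫⁻ z, f z ∂μ = ENNReal.ofReal (r ^ Module.finrank ℝ E) * ∫⁻ z, f (r • z) ∂μ := by
  rw [← lintegral_map hf (measurable_const_smul r), Measure.map_addHaar_smul μ hr.ne',
    lintegral_smul_measure, smul_eq_mul, ← mul_assoc, abs_of_pos (by positivity),
    ← ENNReal.ofReal_mul (by positivity), mul_inv_cancel₀ (by positivity)]
  simp

theorem enorm_smul_rpow {E : Type*} [NormedAddCommGroup E] [NormedSpace ℝ E] {r : ℝ} (hr : 0 < r)
    (z : E) (e : ℝ) : ‖r • z‖ₑ ^ e = ENNReal.ofReal (r ^ e) * ‖z‖ₑ ^ e := by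
  rw [enorm_smul, Real.enorm_of_nonneg hr.le, ENNReal.mul_rpow_of_ne_top (by simp) (by simp),
    ENNReal.ofReal_rpow_of_pos hr]

theorem exists_setLIntegral_ball_enorm_rpow_neg_le (E : Type*) [NormedAddCommGroup E]
    [NormedSpace ℝ E] [FiniteDimensional ℝ E] [MeasurableSpace E] [BorelSpace E]
    (μ : Measure E) [μ.IsAddHaarMeasure] (hE : 1 ≤ Module.finrank ℝ E) {e : ℝ}
    (he : e < Module.finrank ℝ E) :
    ∃ K : ℝ, 0 < K ∧ ∀ r : ℝ, 0 < r →
      ∫⁻ z in Metric.ball (0 : E) r, ‖z‖ₑ ^ (-e) ∂μ ≤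
        ENNReal.ofReal (K * r ^ ((Module.finrank ℝ E : ℝ) - e)) := by
  have hfin := (setLIntegral_ball_enorm_rpow_neg_lt_top μ hE he 1).ne
  -- The constant is the integral over the unit ball, by scaling; the added `1` only makes it
  -- visibly positive.
  refine ⟨(∫⁻ z in Metric.ball (0 : E) 1, ‖z‖ₑ ^ (-e) ∂μ).toReal + 1, by positivity,
    fun r hr => ?_⟩
  have hm : Measurable ((Metric.ball (0 : E) r).indicator fun z => ‖z‖ₑ ^ (-e)) :=
    Measurable.indicator (by fun_prop) measurableSet_ball
  have hcomp : ∀ z : E, (Metric.ball (0 : E) r).indicator (fun z => ‖z‖ₑ ^ (-e)) (r • z) =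
      ENNReal.ofReal (r ^ (-e)) * (Metric.ball (0 : E) 1).indicator (fun z => ‖z‖ₑ ^ (-e)) z := by
    intro z
    have hiff : r • z ∈ Metric.ball (0 : E) r ↔ z ∈ Metric.ball (0 : E) 1 := by
      simp only [mem_ball_zero_iff, norm_smul, Real.norm_of_nonneg hr.le]
      constructor <;> intro h <;> nlinarith
    by_cases hz : z ∈ Metric.ball (0 : E) 1
    · rw [Set.indicator_of_mem hz, Set.indicator_of_mem (hiff.2 hz), enorm_smul_rpow hr]
    · rw [Set.indicator_of_notMem hz, Set.indicator_of_notMem (fun h => hz (hiff.1 h)), mul_zero]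
  rw [← lintegral_indicator measurableSet_ball, lintegral_comp_smul_of_pos μ hm hr]
  simp_rw [hcomp]
  rw [lintegral_const_mul _ (Measurable.indicator (by fun_prop) measurableSet_ball),
    lintegral_indicator measurableSet_ball, ← mul_assoc, ← ENNReal.ofReal_mul (by positivity),
    ← Real.rpow_natCast, ← Real.rpow_add hr, ← sub_eq_add_neg, mul_comm,
    ENNReal.ofReal_mul (by positivity)]
  gcongr
  rw [ENNReal.ofReal_add (by positivity) zero_le_one, ENNReal.ofReal_toReal hfin]
  exact le_self_add

/-- The `p`-th power of the truncated difference quotient of a function of oscillation at most `1`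
and Lipschitz constant `L / w`, integrated against the Gagliardo kernel. -/
theorem exists_lintegral_min_rpow_div_le (E : Type*) [NormedAddCommGroup E]
    [NormedSpace ℝ E] [FiniteDimensional ℝ E] [MeasurableSpace E] [BorelSpace E]
    (μ : Measure E) [μ.IsAddHaarMeasure] (hE : 1 ≤ Module.finrank ℝ E) {s p : ℝ} (hs : 0 < s)
    (hs1 : s < 1) (hp : 1 ≤ p) (L : ℝ≥0) :
    ∃ K : ℝ, 0 < K ∧ ∀ w : ℝ, 0 < w →
      ∫⁻ z, min 1 (L * (‖z‖ₑ / ENNReal.ofReal w)) ^ p /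
          ‖z‖ₑ ^ ((Module.finrank ℝ E : ℝ) + s * p) ∂μ ≤
        ENNReal.ofReal (K * w ^ (-(s * p))) := by
  have : Nontrivial E := Module.nontrivial_of_finrank_pos (R := ℝ) (by omega)
  have hp0 : 0 < p := by linarith
  set n : ℝ := (Module.finrank ℝ E : ℝ) with hn
  set I : ℝ≥0∞ := ∫⁻ z, min 1 (L * ‖z‖ₑ) ^ p * ‖z‖ₑ ^ (-(n + s * p)) ∂μ with hI
  have hfin : I ≠ ⊤ := by
    -- Near the origin the minimum is at most `L ‖z‖`, leaving `‖z‖^((1 - s)p - n)`, integrable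
    -- since `s < 1`; far away it is at most `1`, leaving `‖z‖^(-n - sp)`, integrable since `s > 0`.
    have hsplit : I ≤ (L : ℝ≥0∞) ^ p *
        ∫⁻ z in Metric.ball (0 : E) 1, ‖z‖ₑ ^ (-(n - (1 - s) * p)) ∂μ +
        ∫⁻ z in (Metric.ball (0 : E) 1)ᶜ, ‖z‖ₑ ^ (-(n + s * p)) ∂μ := by
      rw [hI, ← lintegral_add_compl _ (measurableSet_ball (x := (0 : E)) (ε := 1)),
        ← lintegral_const_mul _ (by fun_prop)]
      refine add_le_add (lintegral_mono_ae (ae_restrict_of_ae ?_)) (lintegral_mono fun z => ?_)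
      · filter_upwards [Measure.ae_ne μ 0] with z hz
        calc min 1 (L * ‖z‖ₑ) ^ p * ‖z‖ₑ ^ (-(n + s * p))
            ≤ (L * ‖z‖ₑ) ^ p * ‖z‖ₑ ^ (-(n + s * p)) := by gcongr; exact min_le_right _ _
          _ = L ^ p * ‖z‖ₑ ^ (-(n - (1 - s) * p)) := by
            rw [ENNReal.mul_rpow_of_nonneg _ _ hp0.le, mul_assoc,
              ← ENNReal.rpow_add _ _ (by simpa using hz) (by simp)]
            congr 2; ring
      · calc min 1 (L * ‖z‖ₑ) ^ p * ‖z‖ₑ ^ (-(n + s * p))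
            ≤ 1 ^ p * ‖z‖ₑ ^ (-(n + s * p)) := by gcongr; exact min_le_left _ _
          _ = _ := by simp
    refine (hsplit.trans_lt (ENNReal.add_lt_top.2 ⟨ENNReal.mul_lt_top ?_ ?_, ?_⟩)).ne
    · exact ENNReal.rpow_lt_top_of_nonneg hp0.le (by simp)
    · exact setLIntegral_ball_enorm_rpow_neg_lt_top μ hE (by rw [hn]; nlinarith) 1
    · exact setLIntegral_ball_compl_enorm_rpow_neg_lt_top μ (by rw [hn]; nlinarith [mul_pos hs hp0])
  refine ⟨I.toReal + 1, by positivity, fun w hw => ?_⟩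
  rw [lintegral_comp_smul_of_pos μ (by fun_prop) hw]
  have hcomp : ∀ z : E, min 1 (L * (‖w • z‖ₑ / ENNReal.ofReal w)) ^ p / ‖w • z‖ₑ ^ (n + s * p) =
      ENNReal.ofReal (w ^ (-(n + s * p))) * (min 1 (L * ‖z‖ₑ) ^ p * ‖z‖ₑ ^ (-(n + s * p))) := by
    intro z
    rw [div_eq_mul_inv, ← ENNReal.rpow_neg, enorm_smul_rpow hw, enorm_smul,
      Real.enorm_of_nonneg hw.le, ENNReal.mul_div_right_comm, ENNReal.div_self (by simpa) (by simp),
      one_mul]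
    ring
  simp_rw [hcomp]
  rw [lintegral_const_mul _ (by fun_prop), ← hI, ← mul_assoc, ← ENNReal.ofReal_mul (by positivity),
    ← Real.rpow_natCast, ← Real.rpow_add hw, ← hn, mul_comm, ENNReal.ofReal_mul (by positivity)]
  have : n + -(n + s * p) = -(s * p) := by ring
  rw [this]
  gcongr
  rw [ENNReal.ofReal_add (by positivity) zero_le_one, ENNReal.ofReal_toReal hfin]
  exact le_self_add

/-! ### Geometry, volume and Riesz potential of a thin shell. -/

/-- A spherical shell of radius `R` and width comparable to `w`. -/
def shell (d : ℕ) (R w : ℝ) : Set (EuclideanSpace ℝ (Fin d)) :=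
  {x | |‖x‖ ^ 2 - R ^ 2| ≤ 2 * R * w}

theorem mem_shell {d : ℕ} {R w : ℝ} {x : EuclideanSpace ℝ (Fin d)} :
    x ∈ shell d R w ↔ |‖x‖ ^ 2 - R ^ 2| ≤ 2 * R * w := Iff.rfl

theorem isClosed_shell (d : ℕ) (R w : ℝ) : IsClosed (shell d R w) :=
  isClosed_le (by fun_prop) (by fun_prop)

theorem measurableSet_shell (d : ℕ) (R w : ℝ) : MeasurableSet (shell d R w) :=
  (isClosed_shell d R w).measurableSet

theorem norm_le_of_mem_shell {d : ℕ} {R w : ℝ} (hw : 0 < w) (hR : 4 * w ≤ R)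
    {x : EuclideanSpace ℝ (Fin d)} (hx : x ∈ shell d R w) : ‖x‖ ≤ 5 / 4 * R := by
  have h := (abs_le.1 (mem_shell.1 hx)).2
  exact abs_le_of_sq_le_sq' (by nlinarith) (by linarith) |>.2

theorem le_norm_of_mem_shell {d : ℕ} {R w : ℝ} (hw : 0 < w) (hR : 4 * w ≤ R)
    {x : EuclideanSpace ℝ (Fin d)} (hx : x ∈ shell d R w) : 2 / 3 * R ≤ ‖x‖ := by
  have h := (abs_le.1 (mem_shell.1 hx)).1
  exact abs_le_of_sq_le_sq' (by nlinarith) (norm_nonneg x) |>.2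

/-- This measures a line parallel to a coordinate axis inside the shell, `c` being the sum of
squares of the other coordinates. The second condition makes the line transversal to the sphere: it
forces `|t| ≥ R / (2(m + 1))`. For `t, u` of equal sign, `|t - u| |t + u| ≤ 4Rw` with `|t + u| ≥ R /
(m + 1)` bounds the diameter; the two signs double the bound. -/
theorem volume_slice_le {R w : ℝ} (hw : 0 < w) (hR : 4 * w ≤ R) (m : ℕ) (c : ℝ) :
    volume {t : ℝ | |t ^ 2 + c - R ^ 2| ≤ 2 * R * w ∧ t ^ 2 + c ≤ (m + 1) * t ^ 2} ≤
      ENNReal.ofReal (8 * (m + 1) * w) := by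
  set T : Set ℝ := {t : ℝ | |t ^ 2 + c - R ^ 2| ≤ 2 * R * w ∧ t ^ 2 + c ≤ (m + 1) * t ^ 2}
  have hm : (0 : ℝ) ≤ m := Nat.cast_nonneg m
  have hR0 : 0 < R := by linarith
  have hlow : ∀ t ∈ T, R / (2 * (m + 1)) ≤ |t| := by
    rintro t ⟨h1, h2⟩
    refine abs_le_of_sq_le_sq' ?_ (abs_nonneg t) |>.2
    rw [sq_abs, div_pow, div_le_iff₀ (by positivity)]
    have h3 := (abs_le.1 h1).1
    have h4 : R ^ 2 / 2 ≤ (m + 1) * t ^ 2 := by nlinarith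
    nlinarith [mul_nonneg hm (mul_nonneg (by linarith : (0 : ℝ) ≤ m + 1) (sq_nonneg t)), sq_nonneg t]
  have hdiff : ∀ t ∈ T, ∀ u ∈ T, |t ^ 2 - u ^ 2| ≤ 4 * R * w := by
    rintro t ⟨h1, -⟩ u ⟨h2, -⟩
    rw [abs_le] at *
    constructor <;> linarith
  have key : ∀ t ∈ T, ∀ u ∈ T, 0 ≤ t * u → |t - u| ≤ 4 * (m + 1) * w := by
    intro t ht u hu htu
    have h1 : |t + u| = |t| + |u| := by
      rcases le_total 0 t with h | h <;> rcases le_total 0 u with h' | h'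
      · rw [abs_of_nonneg h, abs_of_nonneg h', abs_of_nonneg (add_nonneg h h')]
      · rcases eq_or_lt_of_le h with rfl | h0
        · simp
        · have : u = 0 := le_antisymm h' (by nlinarith)
          simp [this]
      · rcases eq_or_lt_of_le h' with rfl | h0
        · simp
        · have : t = 0 := le_antisymm h (by nlinarith)
          simp [this]
      · rw [abs_of_nonpos h, abs_of_nonpos h', abs_of_nonpos (add_nonpos h h')]; ring
    have h2 := hdiff t ht u hu
    have h3 : R / (m + 1) ≤ |t + u| := by
      have := add_le_add (hlow t ht) (hlow u hu)
      rw [h1]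
      refine le_trans (le_of_eq ?_) this
      field_simp
      norm_num
    have h4 : |t - u| * |t + u| ≤ 4 * R * w := by
      rw [← abs_mul]; exact (congrArg abs (by ring)).trans_le h2
    have h5 : |t - u| * (R / (m + 1)) ≤ 4 * R * w :=
      (mul_le_mul_of_nonneg_left h3 (abs_nonneg _)).trans h4
    rw [mul_div_assoc', div_le_iff₀ (by positivity)] at h5
    nlinarith
  have hpart : ∀ S ⊆ T, (∀ t ∈ S, ∀ u ∈ S, 0 ≤ t * u) →
      volume S ≤ ENNReal.ofReal (4 * (m + 1) * w) := fun S hS hpos =>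
    (Real.volume_le_diam S).trans <| Metric.ediam_le fun t ht u hu => by
      rw [edist_dist, Real.dist_eq]
      exact ENNReal.ofReal_le_ofReal (key t (hS ht) u (hS hu) (hpos t ht u hu))
  calc volume T ≤ volume (T ∩ Set.Ici 0 ∪ T ∩ Set.Iic 0) := by
        refine measure_mono fun t ht => ?_
        rcases le_total 0 t with h | h
        · exact Or.inl ⟨ht, h⟩
        · exact Or.inr ⟨ht, h⟩
    _ ≤ ENNReal.ofReal (4 * (m + 1) * w) + ENNReal.ofReal (4 * (m + 1) * w) :=
        (measure_union_le _ _).trans (add_le_add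
          (hpart _ Set.inter_subset_left fun t ht u hu => mul_nonneg ht.2 hu.2)
          (hpart _ Set.inter_subset_left fun t ht u hu => mul_nonneg_of_nonpos_of_nonpos ht.2 hu.2))
    _ = _ := by
        rw [← ENNReal.ofReal_add (by positivity) (by positivity)]
        congr 1; ring

/-- The shell behaves like a hypersurface of dimension `n` thickened by `w`. On the piece where the
`i`-th coordinate dominates, deleting that coordinate decreases `‖x - y‖`, so the kernel is bounded
by one on `ℝ^n`, integrable there because `e < n`; the fibres of the projection have length of order
`w`. -/
theorem exists_setLIntegral_shell_le {n : ℕ} (hn : 1 ≤ n) {e : ℝ} (he0 : 0 ≤ e) (he : e < n) :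
    ∃ K : ℝ, 0 < K ∧ ∀ R w : ℝ, 0 < w → 4 * w ≤ R →
      ∀ x : EuclideanSpace ℝ (Fin (n + 1)), ‖x‖ ≤ 2 * R →
        ∫⁻ y in shell (n + 1) R w, ‖x - y‖ₑ ^ (-e) ≤
          ENNReal.ofReal (K * (w * R ^ ((n : ℝ) - e))) := by
  obtain ⟨K, hK, hball⟩ := exists_setLIntegral_ball_enorm_rpow_neg_le (Fin n → ℝ) volume
    (by simpa) (e := e) (by simpa)
  refine ⟨(n + 1) * (8 * (n + 1) * (K * 4 ^ ((n : ℝ) - e))), by positivity,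
    fun R w hw hR x hx => ?_⟩
  have hR0 : 0 < R := by linarith
  set T : Fin (n + 1) → Set (EuclideanSpace ℝ (Fin (n + 1))) :=
    fun i => shell (n + 1) R w ∩ {y | ‖y‖ ^ 2 ≤ (n + 1) * y i ^ 2} with hT
  -- Some squared coordinate is at least the average `‖y‖² / (n + 1)`.
  have hcover : shell (n + 1) R w ⊆ ⋃ i, T i := by
    intro y hy
    by_contra hcon
    simp only [hT, Set.mem_iUnion, Set.mem_inter_iff, Set.mem_ofPred_eq, hy, true_and, not_exists, not_le] at hcon
    have hsum : ∑ i, ((n : ℝ) + 1) * y i ^ 2 < ∑ i : Fin (n + 1), ‖y‖ ^ 2 :=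
      Finset.sum_lt_sum_of_nonempty Finset.univ_nonempty fun i _ => hcon i
    rw [← Finset.mul_sum, Finset.sum_const, Finset.card_univ, Fintype.card_fin, nsmul_eq_mul,
      EuclideanSpace.norm_sq_eq] at hsum
    simp at hsum
  have hTi : ∀ i, ∫⁻ y in T i, ‖x - y‖ₑ ^ (-e) ≤
      ENNReal.ofReal (8 * (n + 1) * (K * 4 ^ ((n : ℝ) - e)) * (w * R ^ ((n : ℝ) - e))) := by
    intro i
    have hmp := (volume_preserving_piFinSuccAbove (fun _ : Fin (n + 1) => ℝ) i).comp
      (PiLp.volume_preserving_ofLp (Fin (n + 1)))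
    set x' : Fin n → ℝ := fun j => x (i.succAbove j)
    set S : Set (ℝ × (Fin n → ℝ)) := {z | |z.1 ^ 2 + ∑ j, z.2 j ^ 2 - R ^ 2| ≤ 2 * R * w} ∩
      {z | z.1 ^ 2 + ∑ j, z.2 j ^ 2 ≤ (n + 1) * z.1 ^ 2}
    set H : (Fin n → ℝ) → ℝ≥0∞ := (Metric.ball 0 (4 * R)).indicator fun z => ‖z‖ₑ ^ (-e)
    have hS : MeasurableSet S := by
      refine MeasurableSet.inter (measurableSet_le ?_ ?_) (measurableSet_le ?_ ?_) <;> fun_prop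
    set χ : ℝ × (Fin n → ℝ) → ℝ≥0∞ := S.indicator fun _ => 1
    have hχ : Measurable χ := measurable_const.indicator hS
    have hH : Measurable H := Measurable.indicator (by fun_prop) measurableSet_ball
    have hG : Measurable fun z : ℝ × (Fin n → ℝ) => χ z * H (x' - z.2) :=
      hχ.mul (hH.comp (by fun_prop))
    have hTm : MeasurableSet (T i) := by
      refine (measurableSet_shell (n + 1) R w).inter (measurableSet_le ?_ ?_) <;> fun_prop
    have hslice : ∀ z : Fin n → ℝ, ∫⁻ t : ℝ, χ (t, z) ≤ ENNReal.ofReal (8 * (n + 1) * w) := by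
      intro z
      have hSz : MeasurableSet ((fun t : ℝ => (t, z)) ⁻¹' S) := measurable_prodMk_right hS
      have heq : (fun t : ℝ => χ (t, z)) = ((fun t : ℝ => (t, z)) ⁻¹' S).indicator fun _ => 1 := rfl
      rw [heq, lintegral_indicator hSz, setLIntegral_one]
      exact volume_slice_le hw hR n (∑ j, z j ^ 2)
    calc ∫⁻ y in T i, ‖x - y‖ₑ ^ (-e)
        ≤ ∫⁻ y : EuclideanSpace ℝ (Fin (n + 1)),
            (fun z : ℝ × (Fin n → ℝ) => χ z * H (x' - z.2))
            ((MeasurableEquiv.piFinSuccAbove (fun _ => ℝ) i ∘ WithLp.ofLp) y) := by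
          rw [← lintegral_indicator hTm]
          refine lintegral_mono fun y => ?_
          by_cases hy : y ∈ T i
          · have hnorm : ‖y‖ ^ 2 = y i ^ 2 + ∑ j : Fin n, y (i.succAbove j) ^ 2 := by
              rw [EuclideanSpace.norm_sq_eq, Fin.sum_univ_succAbove _ i]
              simp
            have hmem : (y i, fun j => y (i.succAbove j)) ∈ S := by
              obtain ⟨h1, h2⟩ := hy
              simp only [shell, Set.mem_ofPred_eq, hnorm] at h1 h2
              exact ⟨h1, h2⟩
            have hle : ‖x' - fun j => y (i.succAbove j)‖ ≤ ‖x - y‖ :=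
              (pi_norm_le_iff_of_nonneg (norm_nonneg _)).2 fun j =>
                PiLp.norm_apply_le (x - y) (i.succAbove j)
            have hlt : ‖x' - fun j => y (i.succAbove j)‖ < 4 * R := by
              have := norm_le_of_mem_shell hw hR hy.1
              have := norm_sub_le x y
              linarith
            rw [Set.indicator_of_mem hy]
            change _ ≤ χ (y i, fun j => y (i.succAbove j)) *
              H (x' - fun j => y (i.succAbove j))
            have hHe : H (x' - fun j => y (i.succAbove j)) =
                ‖x' - fun j => y (i.succAbove j)‖ₑ ^ (-e) :=
              Set.indicator_of_mem (mem_ball_zero_iff.2 hlt) _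
            have hχ1 : χ (y i, fun j => y (i.succAbove j)) = 1 := Set.indicator_of_mem hmem _
            rw [hχ1, one_mul, hHe, ENNReal.rpow_neg,
              ENNReal.rpow_neg]
            gcongr
            exact enorm_le_iff_norm_le.2 hle
          · rw [Set.indicator_of_notMem hy]; exact bot_le
      _ = ∫⁻ z : ℝ × (Fin n → ℝ), χ z * H (x' - z.2) := hmp.lintegral_comp hG
      _ = ∫⁻ z : Fin n → ℝ, ∫⁻ t : ℝ, χ (t, z) * H (x' - z) :=
          lintegral_prod_symm' _ hG
      _ ≤ ∫⁻ z : Fin n → ℝ, ENNReal.ofReal (8 * (n + 1) * w) * H (x' - z) := by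
          refine lintegral_mono fun z => ?_
          exact (lintegral_mul_const (H (x' - z)) (hχ.comp measurable_prodMk_right)).trans_le
            (mul_le_mul_left (hslice z) (H (x' - z)))
      _ = ENNReal.ofReal (8 * (n + 1) * w) * ∫⁻ z in Metric.ball (0 : Fin n → ℝ) (4 * R),
            ‖z‖ₑ ^ (-e) := by
          rw [lintegral_const_mul (f := fun z => H (x' - z)) _ (hH.comp (by fun_prop)),
            lintegral_sub_left_eq_self H x',
            lintegral_indicator measurableSet_ball]
      _ ≤ ENNReal.ofReal (8 * (n + 1) * w) * ENNReal.ofReal (K * (4 * R) ^ ((n : ℝ) - e)) := by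
          gcongr
          simpa using hball (4 * R) (by positivity)
      _ = _ := by
          rw [← ENNReal.ofReal_mul (by positivity), Real.mul_rpow (by norm_num) hR0.le]
          congr 1; ring
  calc ∫⁻ y in shell (n + 1) R w, ‖x - y‖ₑ ^ (-e)
      ≤ ∫⁻ y in ⋃ i, T i, ‖x - y‖ₑ ^ (-e) := lintegral_mono_set hcover
    _ ≤ ∑' i, ∫⁻ y in T i, ‖x - y‖ₑ ^ (-e) := lintegral_iUnion_le _ _
    _ ≤ ∑ i : Fin (n + 1), ENNReal.ofReal
          (8 * (n + 1) * (K * 4 ^ ((n : ℝ) - e)) * (w * R ^ ((n : ℝ) - e))) := by rw [tsum_fintype]; exact Finset.sum_le_sum fun i _ => hTi i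
    _ = _ := by
        rw [Finset.sum_const, Finset.card_univ, Fintype.card_fin, nsmul_eq_mul,
          ← ENNReal.ofReal_natCast, ← ENNReal.ofReal_mul (by positivity)]
        congr 1; push_cast; ring

/-- The annulus `R ≤ ‖x‖ < R + w/3` is contained in the set, since `2Rw/3 + w²/9 ≤ Rw`, and `(R +
w/3)^(n+1) - R^(n+1) ≥ (w/3) R^n`. -/
theorem le_volume_shell {n : ℕ} {R w : ℝ} (hw : 0 < w) (hR : 4 * w ≤ R) :
    ENNReal.ofReal (w / 3 * R ^ n) *
        volume (Metric.ball (0 : EuclideanSpace ℝ (Fin (n + 1))) 1) ≤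
      volume {x : EuclideanSpace ℝ (Fin (n + 1)) | |‖x‖ ^ 2 - R ^ 2| ≤ R * w} := by
  have hR0 : 0 < R := by linarith
  calc ENNReal.ofReal (w / 3 * R ^ n) *
        volume (Metric.ball (0 : EuclideanSpace ℝ (Fin (n + 1))) 1)
      ≤ volume (Metric.ball (0 : EuclideanSpace ℝ (Fin (n + 1))) (R + w / 3)) -
          volume (Metric.ball (0 : EuclideanSpace ℝ (Fin (n + 1))) R) := by
        rw [Measure.addHaar_ball _ 0 (r := R + w / 3) (by positivity),
          Measure.addHaar_ball _ 0 hR0.le,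
          ← ENNReal.sub_mul (fun _ _ => measure_ball_lt_top.ne),
          ← ENNReal.ofReal_sub _ (by positivity)]
        gcongr
        simp only [finrank_euclideanSpace, Fintype.card_fin, pow_succ]
        have : R ^ n ≤ (R + w / 3) ^ n := by gcongr; linarith
        nlinarith
    _ ≤ volume (Metric.ball (0 : EuclideanSpace ℝ (Fin (n + 1))) (R + w / 3) \
          Metric.ball (0 : EuclideanSpace ℝ (Fin (n + 1))) R) := le_measure_sdiff
    _ ≤ _ := by
        refine measure_mono fun x hx => ?_
        simp only [Set.mem_sdiff, mem_ball_zero_iff, not_lt] at hx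
        simp only [Set.mem_ofPred_eq, abs_le]
        constructor <;> nlinarith

/-! ### Radial bumps on shells. -/

/-- A smooth cutoff on the line, equal to `1` on `[-1, 1]` and vanishing outside `(-2, 2)`. -/
noncomputable def lineCutoff : ContDiffBump (0 : ℝ) := ⟨1, 2, one_pos, one_lt_two⟩

/-- A smooth radial bump supported in `shell d R w`. -/
noncomputable def shellBump (d : ℕ) (R w : ℝ) (x : EuclideanSpace ℝ (Fin d)) : ℝ :=
  lineCutoff ((‖x‖ ^ 2 - R ^ 2) / (R * w))

/-- The profile is a function of `‖x‖ ^ 2`, so smoothness at the origin needs no separate argument.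
-/
theorem contDiff_shellBump (d : ℕ) (R w : ℝ) : ContDiff ℝ 1 (shellBump d R w) :=
  lineCutoff.contDiff.comp (((contDiff_norm_sq ℝ).sub contDiff_const).div_const _)

theorem shellBump_nonneg (d : ℕ) (R w : ℝ) (x : EuclideanSpace ℝ (Fin d)) :
    0 ≤ shellBump d R w x := lineCutoff.nonneg

theorem shellBump_le_one (d : ℕ) (R w : ℝ) (x : EuclideanSpace ℝ (Fin d)) :
    shellBump d R w x ≤ 1 := lineCutoff.le_one

theorem shellBump_congr {d : ℕ} {x y : EuclideanSpace ℝ (Fin d)} (h : ‖x‖ = ‖y‖) (R w : ℝ) :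
    shellBump d R w x = shellBump d R w y := by
  rw [shellBump, shellBump, h]

theorem shellBump_eq_zero {d : ℕ} {R w : ℝ} (hw : 0 < w) (hR : 4 * w ≤ R)
    {x : EuclideanSpace ℝ (Fin d)} (hx : x ∉ shell d R w) : shellBump d R w x = 0 := by
  refine lineCutoff.zero_of_le_dist ?_
  have hRw : 0 < R * w := mul_pos (by linarith) hw
  rw [mem_shell, not_le] at hx
  rw [Real.dist_eq, sub_zero, abs_div, abs_of_pos hRw, le_div_iff₀ hRw]
  change 2 * (R * w) ≤ _
  linarith

theorem shellBump_eq_one {d : ℕ} {R w : ℝ} (hw : 0 < w) (hR : 4 * w ≤ R)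
    {x : EuclideanSpace ℝ (Fin d)} (hx : |‖x‖ ^ 2 - R ^ 2| ≤ R * w) : shellBump d R w x = 1 := by
  refine lineCutoff.one_of_mem_closedBall ?_
  have hRw : 0 < R * w := mul_pos (by linarith) hw
  rw [Metric.mem_closedBall, Real.dist_eq, sub_zero, abs_div, abs_of_pos hRw, div_le_iff₀ hRw]
  change _ ≤ 1 * (R * w)
  linarith

theorem tsupport_shellBump_subset {d : ℕ} {R w : ℝ} (hw : 0 < w) (hR : 4 * w ≤ R) :
    tsupport (shellBump d R w) ⊆ shell d R w :=
  closure_minimal (fun _ hx => by_contra fun h => hx (shellBump_eq_zero hw hR h))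
    (isClosed_shell d R w)

theorem hasCompactSupport_shellBump {d : ℕ} {R w : ℝ} (hw : 0 < w) (hR : 4 * w ≤ R) :
    HasCompactSupport (shellBump d R w) :=
  HasCompactSupport.intro (isCompact_closedBall 0 (5 / 4 * R)) fun _ hx =>
    shellBump_eq_zero hw hR fun h => hx (mem_closedBall_zero_iff.2 (norm_le_of_mem_shell hw hR h))

theorem fderiv_shellBump_eq_zero {d : ℕ} {R w : ℝ} (hw : 0 < w) (hR : 4 * w ≤ R)
    {x : EuclideanSpace ℝ (Fin d)} (hx : x ∉ shell d R w) : fderiv ℝ (shellBump d R w) x = 0 :=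
  fderiv_of_notMem_tsupport (𝕜 := ℝ) fun h => hx (tsupport_shellBump_subset hw hR h)

theorem exists_norm_fderiv_shellBump_le : ∃ L : ℝ≥0, ∀ (d : ℕ) (R w : ℝ), 0 < w → 4 * w ≤ R →
    ∀ x, ‖fderiv ℝ (shellBump d R w) x‖ ≤ L / w := by
  obtain ⟨M, hM⟩ := (lineCutoff.hasCompactSupport.deriv).exists_bound_of_continuous
    ((lineCutoff.contDiff (n := 1)).continuous_deriv le_rfl)
  have hM0 : 0 ≤ M := (norm_nonneg _).trans (hM 0)
  -- The gradient of `‖x‖²/(Rw)` has norm `2‖x‖/(Rw)`, and `‖x‖ ≤ 5R/4` on the shell.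
  refine ⟨⟨5 / 2 * M, by positivity⟩, fun d R w hw hR x => ?_⟩
  have hR0 : 0 < R := by linarith
  change _ ≤ (5 / 2 * M) / w
  by_cases hx : x ∈ shell d R w
  · have h1 : HasFDerivAt (fun x : EuclideanSpace ℝ (Fin d) => (‖x‖ ^ 2 - R ^ 2) / (R * w))
        ((R * w)⁻¹ • (2 • innerSL ℝ x)) x := by
      have := ((hasStrictFDerivAt_norm_sq x).hasFDerivAt.sub_const (R ^ 2)).const_smul (R * w)⁻¹
      refine this.congr_of_eventuallyEq (Filter.Eventually.of_forall fun y => ?_)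
      simp [div_eq_inv_mul]
    have h2 : HasDerivAt (lineCutoff : ℝ → ℝ) (deriv lineCutoff ((‖x‖ ^ 2 - R ^ 2) / (R * w)))
        ((‖x‖ ^ 2 - R ^ 2) / (R * w)) :=
      ((lineCutoff.contDiff (n := 1)).differentiable one_ne_zero _).hasDerivAt
    have h3 : HasFDerivAt (shellBump d R w) _ x := h2.comp_hasFDerivAt x h1
    rw [h3.fderiv, norm_smul, norm_smul, norm_inv, Real.norm_of_nonneg (by positivity : 0 ≤ R * w)]
    have h4 : ‖2 • innerSL ℝ x‖ ≤ 2 * (5 / 4 * R) := by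
      refine (norm_nsmul_le (n := 2)).trans ?_
      rw [innerSL_apply_norm]
      have := norm_le_of_mem_shell hw hR hx
      push_cast
      linarith
    calc _ ≤ M * ((R * w)⁻¹ * (2 * (5 / 4 * R))) := by gcongr; exact hM _
      _ = _ := by field_simp; ring
  · rw [fderiv_shellBump_eq_zero hw hR hx, norm_zero]
    positivity

theorem abs_shellBump_sub_le {d : ℕ} {L R w : ℝ}
    (hL : ∀ x, ‖fderiv ℝ (shellBump d R w) x‖ ≤ L / w) (x y : EuclideanSpace ℝ (Fin d)) :
    |shellBump d R w x - shellBump d R w y| ≤ min 1 (L * (‖x - y‖ / w)) := by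
  refine le_min (abs_le.2 ⟨?_, ?_⟩) ?_
  · linarith [shellBump_nonneg d R w x, shellBump_le_one d R w y]
  · linarith [shellBump_nonneg d R w y, shellBump_le_one d R w x]
  · refine (convex_univ.norm_image_sub_le_of_norm_fderiv_le (𝕜 := ℝ) (fun z _ =>
      (contDiff_shellBump d R w).differentiable one_ne_zero z) (fun z _ => hL z)
      (Set.mem_univ y) (Set.mem_univ x)).trans (le_of_eq ?_)
    ring

/-! ### Families of separated shells and superpositions of bumps. -/

section Family

variable {ι : Type*} {R w : ι → ℝ}

/-- Radii and widths of a family of thin shells that are far apart from each other. -/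
structure SeparatedShells (R w : ι → ℝ) : Prop where
  width_pos : ∀ k, 0 < w k
  width_le : ∀ k, 4 * w k ≤ R k
  separated : ∀ k l, k ≠ l → 4 * R k ≤ R l ∨ 4 * R l ≤ R k

theorem SeparatedShells.radius_pos (h : SeparatedShells R w) (k : ι) : 0 < R k := by
  linarith [h.width_pos k, h.width_le k]

/-- Norms in a shell lie between `2R/3` and `5R/4`; when the larger radius is at least four times
the smaller, the gap is at least `2/3 - 5/16 > 1/4` of the larger one. -/
theorem SeparatedShells.max_le_norm_sub (h : SeparatedShells R w) {d : ℕ} {k l : ι} (hkl : k ≠ l)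
    {x y : EuclideanSpace ℝ (Fin d)} (hx : x ∈ shell d (R k) (w k)) (hy : y ∈ shell d (R l) (w l)) :
    max (R k) (R l) / 4 ≤ ‖x - y‖ := by
  have hk := h.radius_pos k
  have hl := h.radius_pos l
  have h1 := norm_le_of_mem_shell (h.width_pos k) (h.width_le k) hx
  have h2 := le_norm_of_mem_shell (h.width_pos k) (h.width_le k) hx
  have h3 := norm_le_of_mem_shell (h.width_pos l) (h.width_le l) hy
  have h4 := le_norm_of_mem_shell (h.width_pos l) (h.width_le l) hy
  have h5 := norm_sub_norm_le x y
  have h6 := norm_sub_norm_le y x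
  rw [norm_sub_rev] at h6
  rcases h.separated k l hkl with h' | h'
  · rw [max_eq_right (by linarith)]; linarith
  · rw [max_eq_left (by linarith)]; linarith

theorem SeparatedShells.disjoint (h : SeparatedShells R w) (d : ℕ) {k l : ι} (hkl : k ≠ l) :
    Disjoint (shell d (R k) (w k)) (shell d (R l) (w l)) :=
  Set.disjoint_left.2 fun x hx hy => by
    have h1 := h.max_le_norm_sub hkl hx hy
    rw [sub_self, norm_zero] at h1
    linarith [h.radius_pos k, le_max_left (R k) (R l)]

variable [Fintype ι]

/-- A superposition of radial bumps with amplitudes `a`, radii `R` and widths `w`. -/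
noncomputable def shellSum (d : ℕ) (a R w : ι → ℝ) (x : EuclideanSpace ℝ (Fin d)) : ℝ :=
  ∑ k, a k * shellBump d (R k) (w k) x

theorem shellSum_mem_C1cRad (h : SeparatedShells R w) (d : ℕ) (a : ι → ℝ) :
    shellSum d a R w ∈ C1cRad d := by
  refine ⟨ContDiff.sum fun k _ => contDiff_const.mul (contDiff_shellBump d (R k) (w k)), ?_,
    fun x y hxy => Finset.sum_congr rfl fun k _ => by rw [shellBump_congr hxy]⟩
  refine HasCompactSupport.intro (isCompact_iUnion fun k =>
    hasCompactSupport_shellBump (d := d) (h.width_pos k) (h.width_le k)) fun x hx =>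
    Finset.sum_eq_zero fun k _ => ?_
  rw [image_eq_zero_of_notMem_tsupport fun hk => hx (Set.mem_iUnion.2 ⟨k, hk⟩), mul_zero]

theorem sum_indicator_rpow {X : Type*} {A : ι → Set X} (hA : Pairwise fun k l => Disjoint (A k) (A l))
    (c : ι → ℝ≥0∞) {p : ℝ} (hp : 0 < p) (x : X) :
    (∑ k, (A k).indicator (fun _ => c k) x) ^ p = ∑ k, (A k).indicator (fun _ => c k ^ p) x := by
  by_cases hx : ∃ k, x ∈ A k
  · obtain ⟨k, hk⟩ := hx
    have hne : ∀ l, l ≠ k → x ∉ A l := fun l hl h => Set.disjoint_left.1 (hA hl) h hk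
    rw [Finset.sum_eq_single_of_mem k (Finset.mem_univ k) fun l _ hl =>
        Set.indicator_of_notMem (hne l hl) _,
      Finset.sum_eq_single_of_mem k (Finset.mem_univ k) fun l _ hl =>
        Set.indicator_of_notMem (hne l hl) _, Set.indicator_of_mem hk, Set.indicator_of_mem hk]
  · push Not at hx
    rw [Finset.sum_eq_zero fun k _ => Set.indicator_of_notMem (hx k) _,
      Finset.sum_eq_zero fun k _ => Set.indicator_of_notMem (hx k) _, ENNReal.zero_rpow_of_pos hp]

theorem enorm_shellSum_le (h : SeparatedShells R w) {d : ℕ} {a : ι → ℝ} (ha : ∀ k, 0 < a k)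
    (x : EuclideanSpace ℝ (Fin d)) : ‖shellSum d a R w x‖ₑ ≤
      ∑ k, (shell d (R k) (w k)).indicator (fun _ => ENNReal.ofReal (a k)) x := by
  refine (enorm_sum_le _ _).trans (Finset.sum_le_sum fun k _ => ?_)
  by_cases hx : x ∈ shell d (R k) (w k)
  · rw [Set.indicator_of_mem hx, Real.enorm_of_nonneg
      (mul_nonneg (ha k).le (shellBump_nonneg d _ _ x))]
    exact ENNReal.ofReal_le_ofReal (mul_le_of_le_one_right (ha k).le (shellBump_le_one d _ _ x))
  · rw [shellBump_eq_zero (h.width_pos k) (h.width_le k) hx]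
    simp

theorem enorm_fderiv_shellSum_le (h : SeparatedShells R w) {d : ℕ} {a : ι → ℝ} (ha : ∀ k, 0 < a k)
    {L : ℝ} (hL : ∀ k x, ‖fderiv ℝ (shellBump d (R k) (w k)) x‖ ≤ L / w k)
    (x : EuclideanSpace ℝ (Fin d)) : ‖fderiv ℝ (shellSum d a R w) x‖ₑ ≤
      ∑ k, (shell d (R k) (w k)).indicator (fun _ => ENNReal.ofReal (a k * (L / w k))) x := by
  have hdiff : ∀ k, DifferentiableAt ℝ (shellBump d (R k) (w k)) x := fun k =>
    (contDiff_shellBump d (R k) (w k)).differentiable one_ne_zero x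
  have hfd : fderiv ℝ (shellSum d a R w) x =
      ∑ k, a k • fderiv ℝ (shellBump d (R k) (w k)) x :=
    (HasFDerivAt.fun_sum fun k _ => (hdiff k).hasFDerivAt.const_mul (a k)).fderiv
  rw [hfd]
  refine (enorm_sum_le (ε := EuclideanSpace ℝ (Fin d) →L[ℝ] ℝ) Finset.univ _).trans (Finset.sum_le_sum fun k _ => ?_)
  by_cases hx : x ∈ shell d (R k) (w k)
  · rw [Set.indicator_of_mem hx, ← ofReal_norm, norm_smul, Real.norm_of_nonneg (ha k).le]
    exact ENNReal.ofReal_le_ofReal (mul_le_mul_of_nonneg_left (hL k x) (ha k).le)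
  · rw [fderiv_shellBump_eq_zero (h.width_pos k) (h.width_le k) hx, smul_zero, ← ofReal_norm, norm_zero,
      ENNReal.ofReal_zero]
    exact bot_le

/-- By disjointness at most one bump is nonzero at `x` and at most one at `y`, so the difference has
at most two nonzero terms. Convexity then costs `2^(p - 1)`, whatever the number of shells, and the
nonlocal seminorm becomes additive up to a constant. -/
theorem enorm_shellSum_sub_rpow_le (h : SeparatedShells R w) {d : ℕ} {a : ι → ℝ} {p : ℝ}
    (hp : 1 ≤ p) (x y : EuclideanSpace ℝ (Fin d)) :
    ‖shellSum d a R w x - shellSum d a R w y‖ₑ ^ p ≤ (2 : ℝ≥0∞) ^ (p - 1) * ∑ k,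
      ‖a k * (shellBump d (R k) (w k) x - shellBump d (R k) (w k) y)‖ₑ ^ p := by
  classical
  set S : EuclideanSpace ℝ (Fin d) → Finset ι := fun z =>
    Finset.univ.filter fun k => z ∈ shell d (R k) (w k)
  have hS : ∀ z, (S z).card ≤ 1 := fun z => Finset.card_le_one.2 fun k hk l hl => by
    by_contra hkl
    exact Set.disjoint_left.1 (h.disjoint d hkl) (Finset.mem_filter.1 hk).2
      (Finset.mem_filter.1 hl).2
  have hz : ∀ z, ∀ k ∉ S z, shellBump d (R k) (w k) z = 0 := fun z k hk =>
    shellBump_eq_zero (h.width_pos k) (h.width_le k) fun hmem =>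
      hk (Finset.mem_filter.2 ⟨Finset.mem_univ k, hmem⟩)
  have heq : shellSum d a R w x - shellSum d a R w y =
      ∑ k ∈ S x ∪ S y, a k * (shellBump d (R k) (w k) x - shellBump d (R k) (w k) y) := by
    rw [shellSum, shellSum, ← Finset.sum_sub_distrib]
    simp_rw [← mul_sub]
    refine (Finset.sum_subset (Finset.subset_univ _) fun k _ hk => ?_).symm
    rw [Finset.mem_union, not_or] at hk
    rw [hz x k hk.1, hz y k hk.2, sub_zero, mul_zero]
  have hcard : (S x ∪ S y).card ≤ 2 := (Finset.card_union_le _ _).trans (add_le_add (hS x) (hS y))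
  have hp0 : 0 ≤ p - 1 := by linarith
  rw [heq]
  calc _ ≤ (∑ k ∈ S x ∪ S y,
        ‖a k * (shellBump d (R k) (w k) x - shellBump d (R k) (w k) y)‖ₑ) ^ p := by
        gcongr; exact enorm_sum_le _ _
    _ ≤ _ := ENNReal.rpow_sum_le_const_mul_sum_rpow _ _ hp
    _ ≤ _ := by
        gcongr
        · exact_mod_cast hcard
        · exact Finset.subset_univ _

end Family

/-! ### The three functionals on superpositions, with constants uniform in the family. -/

theorem exists_volume_shell_le {n : ℕ} (hn : 1 ≤ n) :
    ∃ K : ℝ, 0 < K ∧ ∀ R w : ℝ, 0 < w → 4 * w ≤ R →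
      volume (shell (n + 1) R w) ≤ ENNReal.ofReal (K * (w * R ^ n)) := by
  obtain ⟨K, hK, h⟩ := exists_setLIntegral_shell_le hn (e := 0) le_rfl (by exact_mod_cast hn)
  refine ⟨K, hK, fun R w hw hR => ?_⟩
  have := h R w hw hR 0 (by rw [norm_zero]; linarith)
  simpa using this

theorem lintegral_lintegral_finsetSum {ι X Y : Type*} [MeasurableSpace X] [MeasurableSpace Y]
    (μ : Measure X) (ν : Measure Y) [SFinite ν] (S : Finset ι) {f : ι → X → Y → ℝ≥0∞}
    (hf : ∀ k, Measurable (Function.uncurry (f k))) :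
    ∫⁻ x, ∫⁻ y, ∑ k ∈ S, f k x y ∂ν ∂μ = ∑ k ∈ S, ∫⁻ x, ∫⁻ y, f k x y ∂ν ∂μ := by
  have hF : ∀ k, Measurable fun x => ∫⁻ y, f k x y ∂ν := fun k => (hf k).lintegral_prod_right'
  rw [← lintegral_finsetSum _ fun k _ => hF k]
  refine lintegral_congr fun x => lintegral_finsetSum _ fun k _ => ?_
  exact (hf k).comp measurable_prodMk_left

theorem lintegral_lintegral_sum_mul_sum_mul {ι X : Type*} [MeasurableSpace X] (μ : Measure X)
    [SFinite μ] (S : Finset ι) {f : ι → X → ℝ≥0∞} (hf : ∀ k, Measurable (f k))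
    {κ : X → X → ℝ≥0∞} (hκ : Measurable (Function.uncurry κ)) :
    ∫⁻ x, ∫⁻ y, (∑ k ∈ S, f k x) * (∑ l ∈ S, f l y) * κ x y ∂μ ∂μ =
      ∑ k ∈ S, ∑ l ∈ S, ∫⁻ x, f k x * ∫⁻ y, f l y * κ x y ∂μ ∂μ := by
  have hm : ∀ k l, Measurable (Function.uncurry fun x y => f k x * (f l y * κ x y)) := fun k l =>
    ((hf k).comp measurable_fst).mul (((hf l).comp measurable_snd).mul hκ)
  have hms : ∀ k, Measurable (Function.uncurry fun x y => ∑ l ∈ S, f k x * (f l y * κ x y)) :=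
    fun k => Finset.measurable_fun_sum S fun l _ => hm k l
  have hexp : ∀ x y, (∑ k ∈ S, f k x) * (∑ l ∈ S, f l y) * κ x y =
      ∑ k ∈ S, ∑ l ∈ S, f k x * (f l y * κ x y) := fun x y => by
    rw [Finset.sum_mul_sum, Finset.sum_mul]
    simp_rw [Finset.sum_mul, mul_assoc]
  simp_rw [hexp]
  rw [lintegral_lintegral_finsetSum μ μ S hms]
  refine Finset.sum_congr rfl fun k _ => ?_
  rw [lintegral_lintegral_finsetSum μ μ S (hm k)]
  refine Finset.sum_congr rfl fun l _ => lintegral_congr fun x => ?_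
  exact lintegral_const_mul _ (((hf l).mul (hκ.comp measurable_prodMk_left)))

section

variable {ι : Type*} [Fintype ι] {R w a : ι → ℝ}

theorem exists_le_lintegral_shellSum_rpow (n : ℕ) (γ : ℝ) (hγ : 0 < γ) :
    ∃ c : ℝ, 0 < c ∧ ∀ {ι : Type} [Fintype ι] {R w a : ι → ℝ}, SeparatedShells R w →
      (∀ k, 0 < a k) →
      ENNReal.ofReal (c * ∑ k, a k ^ γ * (w k * R k ^ n)) ≤
        ∫⁻ x, ‖shellSum (n + 1) a R w x‖ₑ ^ γ := by
  set v := volume (Metric.ball (0 : EuclideanSpace ℝ (Fin (n + 1))) 1) with hv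
  have hv0 : v ≠ 0 := (Metric.measure_ball_pos volume _ one_pos).ne'
  have hvt : v ≠ ⊤ := measure_ball_lt_top.ne
  refine ⟨v.toReal / 3, by have := ENNReal.toReal_pos hv0 hvt; positivity, ?_⟩
  intro ι _ R w a h ha
  set B : ι → Set (EuclideanSpace ℝ (Fin (n + 1))) := fun k => {x | |‖x‖ ^ 2 - R k ^ 2| ≤ R k * w k}
  have hBA : ∀ k, B k ⊆ shell (n + 1) (R k) (w k) := fun k x hx => by
    rw [mem_shell]
    have hx' : |‖x‖ ^ 2 - R k ^ 2| ≤ R k * w k := hx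
    nlinarith [mul_pos (h.radius_pos k) (h.width_pos k)]
  have hBm : ∀ k, MeasurableSet (B k) := fun k => measurableSet_le (by fun_prop) (by fun_prop)
  have hBd : Pairwise fun k l => Disjoint (B k) (B l) := fun k l hkl =>
    (h.disjoint (n + 1) hkl).mono (hBA k) (hBA l)
  have hnn : ∀ k, 0 ≤ a k ^ γ * (w k * R k ^ n) := fun k => by
    have := ha k; have := h.width_pos k; have := h.radius_pos k; positivity
  have hval : ∀ k, ∀ x ∈ B k, ENNReal.ofReal (a k) ≤ ‖shellSum (n + 1) a R w x‖ₑ := by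
    intro k x hx
    have hterm : ∀ l, 0 ≤ a l * shellBump (n + 1) (R l) (w l) x := fun l =>
      mul_nonneg (ha l).le (shellBump_nonneg _ _ _ x)
    rw [shellSum, Real.enorm_of_nonneg (Finset.sum_nonneg fun l _ => hterm l)]
    refine ENNReal.ofReal_le_ofReal ?_
    refine le_trans (le_of_eq ?_) (Finset.single_le_sum (fun l _ => hterm l) (Finset.mem_univ k))
    rw [shellBump_eq_one (h.width_pos k) (h.width_le k) hx, mul_one]
  calc ENNReal.ofReal (v.toReal / 3 * ∑ k, a k ^ γ * (w k * R k ^ n))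
      = ∑ k, ENNReal.ofReal (v.toReal / 3 * (a k ^ γ * (w k * R k ^ n))) := by
        rw [Finset.mul_sum, ENNReal.ofReal_sum_of_nonneg]
        exact fun k _ => mul_nonneg (by positivity) (hnn k)
    _ ≤ ∑ k, ∫⁻ x in B k, ‖shellSum (n + 1) a R w x‖ₑ ^ γ := by
        refine Finset.sum_le_sum fun k _ => ?_
        have hak := ha k
        have hwk := h.width_pos k
        have hRk := h.radius_pos k
        calc ENNReal.ofReal (v.toReal / 3 * (a k ^ γ * (w k * R k ^ n)))
            = ENNReal.ofReal (a k) ^ γ * (ENNReal.ofReal (w k / 3 * R k ^ n) * v) := by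
              rw [ENNReal.ofReal_rpow_of_pos hak, ← ENNReal.ofReal_toReal hvt,
                ← ENNReal.ofReal_mul (by positivity), ← ENNReal.ofReal_mul (by positivity),
                ENNReal.toReal_ofReal (by positivity)]
              congr 1; ring
          _ ≤ ENNReal.ofReal (a k) ^ γ * volume (B k) := by
              gcongr; exact le_volume_shell hwk (h.width_le k)
          _ = ∫⁻ _ in B k, ENNReal.ofReal (a k) ^ γ := (setLIntegral_const _ _).symm
          _ ≤ _ := setLIntegral_mono' (hBm k) fun x hx =>
              ENNReal.rpow_le_rpow (hval k x hx) hγ.le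
    _ = ∫⁻ x in ⋃ k, B k, ‖shellSum (n + 1) a R w x‖ₑ ^ γ := by
        rw [lintegral_iUnion hBm hBd, tsum_fintype]
    _ ≤ _ := setLIntegral_le_lintegral _ _

theorem lintegral_sum_indicator_shell {d : ℕ} (c : ι → ℝ≥0∞) :
    ∫⁻ x, ∑ k, (shell d (R k) (w k)).indicator (fun _ => c k) x =
      ∑ k, c k * volume (shell d (R k) (w k)) := by
  rw [lintegral_finsetSum _ fun k _ => measurable_const.indicator (measurableSet_shell _ _ _)]
  exact Finset.sum_congr rfl fun k _ => lintegral_indicator_const (measurableSet_shell _ _ _) _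

theorem exists_lintegral_fderiv_shellSum_rpow_le {n : ℕ} (hn : 1 ≤ n) {p : ℝ} (hp : 1 ≤ p) :
    ∃ C : ℝ, 0 < C ∧ ∀ {ι : Type} [Fintype ι] {R w a : ι → ℝ}, SeparatedShells R w →
      (∀ k, 0 < a k) →
      ∫⁻ x, ‖fderiv ℝ (shellSum (n + 1) a R w) x‖ₑ ^ p ≤
        ENNReal.ofReal (C * ∑ k, a k ^ p * w k ^ (1 - p) * R k ^ n) := by
  obtain ⟨K, hK, hvol⟩ := exists_volume_shell_le hn
  obtain ⟨L, hL⟩ := exists_norm_fderiv_shellBump_le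
  have hp0 : 0 < p := by linarith
  refine ⟨(L + 1) ^ p * K, by positivity, ?_⟩
  intro ι _ R w a h ha
  have hL' : ∀ k x, ‖fderiv ℝ (shellBump (n + 1) (R k) (w k)) x‖ ≤ ((L : ℝ) + 1) / w k :=
    fun k x => (hL _ _ _ (h.width_pos k) (h.width_le k) x).trans <| by
      have := h.width_pos k
      gcongr; linarith
  calc ∫⁻ x, ‖fderiv ℝ (shellSum (n + 1) a R w) x‖ₑ ^ p
      ≤ ∫⁻ x, ∑ k, (shell (n + 1) (R k) (w k)).indicator
          (fun _ => ENNReal.ofReal (a k * ((L + 1) / w k)) ^ p) x := by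
        refine lintegral_mono fun x => ?_
        rw [← sum_indicator_rpow (fun k l hkl => h.disjoint (n + 1) hkl) _ hp0]
        exact ENNReal.rpow_le_rpow (enorm_fderiv_shellSum_le h ha hL' x) hp0.le
    _ = ∑ k, ENNReal.ofReal (a k * ((L + 1) / w k)) ^ p * volume (shell (n + 1) (R k) (w k)) :=
        lintegral_sum_indicator_shell _
    _ ≤ ∑ k, ENNReal.ofReal ((L + 1) ^ p * K * (a k ^ p * w k ^ (1 - p) * R k ^ n)) := by
        refine Finset.sum_le_sum fun k _ => ?_
        have hak := ha k
        have hwk := h.width_pos k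
        have hRk := h.radius_pos k
        calc _ ≤ ENNReal.ofReal (a k * ((L + 1) / w k)) ^ p *
              ENNReal.ofReal (K * (w k * R k ^ n)) := by
              gcongr; exact hvol _ _ hwk (h.width_le k)
          _ = _ := by
              rw [ENNReal.ofReal_rpow_of_pos (by positivity), ← ENNReal.ofReal_mul (by positivity),
                Real.mul_rpow hak.le (by positivity), Real.div_rpow (by positivity) hwk.le,
                Real.rpow_sub hwk, Real.rpow_one]
              congr 1; ring
    _ = _ := by
        rw [Finset.mul_sum, ENNReal.ofReal_sum_of_nonneg]
        intro k _
        have := ha k; have := h.width_pos k; have := h.radius_pos k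
        positivity

/-- The integrand vanishes unless `x` or `y` lies in the shell, and is dominated by a function of `x
- y`. Integrating first over the other variable gives the same bound in both cases, whence the
factor `2`. -/
theorem lintegral_shellBump_gagliardo_le {d : ℕ} {s p R w a : ℝ} {L : ℝ≥0} (hp : 0 < p)
    (hw : 0 < w) (hR : 4 * w ≤ R) (ha : 0 < a)
    (hL : ∀ x, ‖fderiv ℝ (shellBump d R w) x‖ ≤ L / w) :
    ∫⁻ x, ∫⁻ y, ‖a * (shellBump d R w x - shellBump d R w y)‖ₑ ^ p /
        ‖x - y‖ₑ ^ ((d : ℝ) + s * p) ≤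
      ENNReal.ofReal a ^ p * (2 * volume (shell d R w) *
        ∫⁻ z : EuclideanSpace ℝ (Fin d), min 1 (L * (‖z‖ₑ / ENNReal.ofReal w)) ^ p /
          ‖z‖ₑ ^ ((d : ℝ) + s * p)) := by
  set A := shell d R w
  set M : EuclideanSpace ℝ (Fin d) → ℝ≥0∞ := fun z =>
    min 1 (L * (‖z‖ₑ / ENNReal.ofReal w)) ^ p / ‖z‖ₑ ^ ((d : ℝ) + s * p)
  set χ : EuclideanSpace ℝ (Fin d) → ℝ≥0∞ := A.indicator fun _ => 1
  have hM : Measurable M := by fun_prop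
  have hχ : Measurable χ := measurable_const.indicator (measurableSet_shell d R w)
  have hχA : ∫⁻ x, χ x = volume A := by
    rw [lintegral_indicator (measurableSet_shell d R w), setLIntegral_one]
  have hpt : ∀ x y, ‖a * (shellBump d R w x - shellBump d R w y)‖ₑ ^ p /
      ‖x - y‖ₑ ^ ((d : ℝ) + s * p) ≤
      ENNReal.ofReal a ^ p * (χ x * M (x - y)) + ENNReal.ofReal a ^ p * (χ y * M (x - y)) := by
    intro x y
    by_cases hxy : x ∈ A ∨ y ∈ A
    · have h1 : 1 ≤ χ x + χ y := by
        rcases hxy with hx | hy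
        · rw [show χ x = 1 from Set.indicator_of_mem hx _]; exact le_self_add
        · rw [show χ y = 1 from Set.indicator_of_mem hy _]; exact le_add_self
      have h2 : ‖shellBump d R w x - shellBump d R w y‖ₑ ≤
          min 1 (L * (‖x - y‖ₑ / ENNReal.ofReal w)) := by
        rw [Real.enorm_eq_ofReal_abs, ← ofReal_norm (x - y), ← ENNReal.ofReal_div_of_pos hw,
          ← ENNReal.ofReal_coe_nnreal, ← ENNReal.ofReal_mul L.coe_nonneg, ← ENNReal.ofReal_one,
          ← ENNReal.ofReal_min]
        exact ENNReal.ofReal_le_ofReal (abs_shellBump_sub_le hL x y)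
      calc _ ≤ ENNReal.ofReal a ^ p * M (x - y) := by
            rw [enorm_mul, Real.enorm_of_nonneg ha.le, ENNReal.mul_rpow_of_nonneg _ _ hp.le,
              mul_div_assoc]
            exact mul_le_mul_right (ENNReal.div_le_div_right (ENNReal.rpow_le_rpow h2 hp.le) _) _
        _ ≤ ENNReal.ofReal a ^ p * ((χ x + χ y) * M (x - y)) :=
            mul_le_mul_right (le_mul_of_one_le_left bot_le h1) _
        _ = _ := by ring
    · push Not at hxy
      rw [shellBump_eq_zero hw hR hxy.1, shellBump_eq_zero hw hR hxy.2, sub_zero, mul_zero,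
        enorm_zero]
      rw [ENNReal.zero_rpow_of_pos hp, ENNReal.zero_div]
      exact bot_le
  have hI1 : ∫⁻ x, ∫⁻ y, χ x * M (x - y) = volume A * ∫⁻ z, M z := by
    rw [← hχA, ← lintegral_mul_const _ hχ]
    refine lintegral_congr fun x => ?_
    rw [lintegral_const_mul (f := fun y => M (x - y)) _ (hM.comp (by fun_prop)),
      lintegral_sub_left_eq_self M x]
  have hI2 : ∫⁻ x, ∫⁻ y, χ y * M (x - y) = volume A * ∫⁻ z, M z := by
    have hm : Measurable fun z : EuclideanSpace ℝ (Fin d) × EuclideanSpace ℝ (Fin d) =>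
        χ z.2 * M (z.1 - z.2) := (hχ.comp measurable_snd).mul (hM.comp (by fun_prop))
    rw [lintegral_lintegral_swap hm.aemeasurable, ← hχA, ← lintegral_mul_const _ hχ]
    refine lintegral_congr fun y => ?_
    rw [lintegral_const_mul (f := fun x => M (x - y)) _ (hM.comp (by fun_prop)),
      lintegral_sub_right_eq_self M y]
  have hm1 : Measurable fun z : EuclideanSpace ℝ (Fin d) × EuclideanSpace ℝ (Fin d) =>
      ENNReal.ofReal a ^ p * (χ z.1 * M (z.1 - z.2)) :=
    ((hχ.comp measurable_fst).mul (hM.comp (by fun_prop))).const_mul _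
  have hap : ENNReal.ofReal a ^ p ≠ ⊤ := ENNReal.rpow_ne_top_of_nonneg hp.le ENNReal.ofReal_ne_top
  calc _ ≤ ∫⁻ x, ∫⁻ y, (ENNReal.ofReal a ^ p * (χ x * M (x - y)) +
        ENNReal.ofReal a ^ p * (χ y * M (x - y))) :=
        lintegral_mono fun x => lintegral_mono fun y => hpt x y
    _ = ∫⁻ x, ((∫⁻ y, ENNReal.ofReal a ^ p * (χ x * M (x - y))) +
        ∫⁻ y, ENNReal.ofReal a ^ p * (χ y * M (x - y))) :=
        lintegral_congr fun x => lintegral_add_left (hm1.comp measurable_prodMk_left) _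
    _ = ENNReal.ofReal a ^ p * (volume A * ∫⁻ z, M z) +
        ENNReal.ofReal a ^ p * (volume A * ∫⁻ z, M z) := by
        rw [lintegral_add_left hm1.lintegral_prod_right']
        simp_rw [lintegral_const_mul' _ _ hap]
        rw [hI1, hI2]
    _ = _ := by ring

theorem exists_lintegral_shellSum_gagliardo_le {n : ℕ} (hn : 1 ≤ n) {s p : ℝ} (hs : 0 < s)
    (hs1 : s < 1) (hp : 1 ≤ p) :
    ∃ C : ℝ, 0 < C ∧ ∀ {ι : Type} [Fintype ι] {R w a : ι → ℝ}, SeparatedShells R w →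
      (∀ k, 0 < a k) →
      ∫⁻ x, ∫⁻ y, ‖shellSum (n + 1) a R w x - shellSum (n + 1) a R w y‖ₑ ^ p /
          ‖x - y‖ₑ ^ (((n + 1 : ℕ) : ℝ) + s * p) ≤
        ENNReal.ofReal (C * ∑ k, a k ^ p * w k ^ (1 - s * p) * R k ^ n) := by
  obtain ⟨K, hK, hvol⟩ := exists_volume_shell_le hn
  obtain ⟨L, hL⟩ := exists_norm_fderiv_shellBump_le
  have hp0 : 0 < p := by linarith
  obtain ⟨J, hJ, hker⟩ := exists_lintegral_min_rpow_div_le (EuclideanSpace ℝ (Fin (n + 1)))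
    volume (by simp) hs hs1 hp L
  rw [finrank_euclideanSpace, Fintype.card_fin] at hker
  refine ⟨2 ^ (p - 1) * (2 * K * J), by positivity, ?_⟩
  intro ι _ R w a h ha
  set f : ι → EuclideanSpace ℝ (Fin (n + 1)) → EuclideanSpace ℝ (Fin (n + 1)) → ℝ≥0∞ :=
    fun k x y => ‖a k * (shellBump (n + 1) (R k) (w k) x - shellBump (n + 1) (R k) (w k) y)‖ₑ ^ p /
        ‖x - y‖ₑ ^ (((n + 1 : ℕ) : ℝ) + s * p) with hf
  have hfm : ∀ k, Measurable (Function.uncurry (f k)) := fun k => by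
    have := (contDiff_shellBump (n + 1) (R k) (w k)).continuous.measurable
    simp only [hf, Function.uncurry_def]
    fun_prop
  calc _ ≤ ∫⁻ x, ∫⁻ y, (2 : ℝ≥0∞) ^ (p - 1) * ∑ k, f k x y := by
        refine lintegral_mono fun x => lintegral_mono fun y => ?_
        refine (ENNReal.div_le_div_right (enorm_shellSum_sub_rpow_le h hp x y) _).trans_eq ?_
        simp only [hf, div_eq_mul_inv, Finset.sum_mul, mul_assoc]
    _ = (2 : ℝ≥0∞) ^ (p - 1) * ∑ k, ∫⁻ x, ∫⁻ y, f k x y := by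
        have h2 : (2 : ℝ≥0∞) ^ (p - 1) ≠ ⊤ :=
          ENNReal.rpow_ne_top_of_nonneg (by linarith) (by simp)
        simp_rw [lintegral_const_mul' _ _ h2]
        rw [lintegral_lintegral_finsetSum volume volume Finset.univ hfm]
    _ ≤ (2 : ℝ≥0∞) ^ (p - 1) * ∑ k, ENNReal.ofReal
          (2 * K * J * (a k ^ p * w k ^ (1 - s * p) * R k ^ n)) := by
        gcongr with k
        have hak := ha k
        have hwk := h.width_pos k
        have hRk := h.radius_pos k
        calc _ ≤ _ := lintegral_shellBump_gagliardo_le hp0 hwk (h.width_le k) hak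
              (hL (n + 1) _ _ hwk (h.width_le k))
          _ ≤ ENNReal.ofReal (a k) ^ p * (ENNReal.ofReal 2 * ENNReal.ofReal (K * (w k * R k ^ n)) *
              ENNReal.ofReal (J * w k ^ (-(s * p)))) := by
              gcongr
              · simp
              · exact hvol _ _ hwk (h.width_le k)
              · exact hker _ hwk
          _ = _ := by
              rw [ENNReal.ofReal_rpow_of_pos hak, ← ENNReal.ofReal_mul (by positivity),
                ← ENNReal.ofReal_mul (by positivity), ← ENNReal.ofReal_mul (by positivity),
                sub_eq_add_neg, Real.rpow_add hwk, Real.rpow_one]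
              congr 1; ring
    _ = _ := by
        have h2 : (2 : ℝ≥0∞) ^ (p - 1) = ENNReal.ofReal (2 ^ (p - 1)) := by
          rw [← ENNReal.ofReal_rpow_of_pos two_pos]; simp
        have hnn : ∀ k, 0 ≤ a k ^ p * w k ^ (1 - s * p) * R k ^ n := fun k => by
          have := ha k; have := h.width_pos k; have := h.radius_pos k; positivity
        rw [← ENNReal.ofReal_sum_of_nonneg fun k _ => mul_nonneg (by positivity) (hnn k), h2,
          ← ENNReal.ofReal_mul (by positivity), ← Finset.mul_sum, ← mul_assoc]

/-- On the diagonal the potential of the shell is bounded pointwise; off the diagonal the kernel is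
at most `(max (R k) (R l) / 4)^(-e)`. The two terms of the constant serve these two cases. -/
theorem exists_lintegral_shell_pair_le {n : ℕ} (hn : 1 ≤ n) {e : ℝ} (he0 : 0 ≤ e) (he : e < n) :
    ∃ K : ℝ, 0 < K ∧ ∀ {ι : Type} {R w : ι → ℝ}, SeparatedShells R w → ∀ k l,
      ∫⁻ x in shell (n + 1) (R k) (w k), ∫⁻ y in shell (n + 1) (R l) (w l), ‖x - y‖ₑ ^ (-e) ≤
        ENNReal.ofReal (K * (w k * R k ^ n * (w l * R l ^ n) * max (R k) (R l) ^ (-e))) := by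
  obtain ⟨V, hV, hvol⟩ := exists_volume_shell_le hn
  obtain ⟨K, hK, hpot⟩ := exists_setLIntegral_shell_le hn he0 he
  refine ⟨V * K + V * V * 4 ^ e, by positivity, ?_⟩
  intro ι R w h k l
  have hwk := h.width_pos k
  have hRk := h.radius_pos k
  have hwl := h.width_pos l
  have hRl := h.radius_pos l
  have hm : 0 < max (R k) (R l) := lt_max_of_lt_left hRk
  have hbound : ∀ {c : ℝ}, 0 ≤ c → (∀ x ∈ shell (n + 1) (R k) (w k),
      ∫⁻ y in shell (n + 1) (R l) (w l), ‖x - y‖ₑ ^ (-e) ≤ ENNReal.ofReal c) →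
      ∫⁻ x in shell (n + 1) (R k) (w k), ∫⁻ y in shell (n + 1) (R l) (w l), ‖x - y‖ₑ ^ (-e) ≤
        ENNReal.ofReal (c * (V * (w k * R k ^ n))) := fun {c} hc hx => by
    refine (setLIntegral_mono' (measurableSet_shell _ _ _) hx).trans ?_
    rw [setLIntegral_const, ENNReal.ofReal_mul hc]
    gcongr
    exact hvol _ _ hwk (h.width_le k)
  by_cases hkl : k = l
  · subst hkl
    refine (hbound (c := K * (w k * R k ^ ((n : ℝ) - e))) (by positivity) fun x hx =>
      hpot _ _ hwk (h.width_le k) x ?_).trans (ENNReal.ofReal_le_ofReal ?_)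
    · have := norm_le_of_mem_shell hwk (h.width_le k) hx
      linarith
    · rw [max_self, sub_eq_add_neg, Real.rpow_add hRk, Real.rpow_natCast, add_mul]
      refine le_add_of_le_of_nonneg (le_of_eq (by ring)) (by positivity)
  · refine (hbound (c := (max (R k) (R l) / 4) ^ (-e) * (V * (w l * R l ^ n))) (by positivity)
      fun x hx => ?_).trans (ENNReal.ofReal_le_ofReal ?_)
    · calc ∫⁻ y in shell (n + 1) (R l) (w l), ‖x - y‖ₑ ^ (-e)
          ≤ ∫⁻ _ in shell (n + 1) (R l) (w l),
              ENNReal.ofReal ((max (R k) (R l) / 4) ^ (-e)) := by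
            refine setLIntegral_mono' (measurableSet_shell _ _ _) fun y hy => ?_
            rw [← ENNReal.ofReal_rpow_of_pos (by positivity), ENNReal.rpow_neg, ENNReal.rpow_neg,
              ← ofReal_norm]
            gcongr
            exact h.max_le_norm_sub hkl hx hy
        _ ≤ _ := by
            rw [setLIntegral_const, ENNReal.ofReal_mul (by positivity)]
            gcongr
            exact hvol _ _ hwl (h.width_le l)
    · rw [Real.div_rpow hm.le (by norm_num), Real.rpow_neg (by norm_num : (0 : ℝ) ≤ 4), div_inv_eq_mul,
        add_mul]
      refine le_add_of_nonneg_of_le (by positivity) (le_of_eq (by ring))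

theorem exists_lintegral_shellSum_coulomb_le {n : ℕ} (hn : 1 ≤ n) {e q : ℝ} (he0 : 0 ≤ e)
    (he : e < n) (hq : 0 < q) :
    ∃ C : ℝ, 0 < C ∧ ∀ {ι : Type} [Fintype ι] {R w a : ι → ℝ}, SeparatedShells R w →
      (∀ k, 0 < a k) →
      ∫⁻ x, ∫⁻ y, ‖shellSum (n + 1) a R w x‖ₑ ^ q * ‖shellSum (n + 1) a R w y‖ₑ ^ q /
          ‖x - y‖ₑ ^ e ≤
        ENNReal.ofReal (C * ∑ k, ∑ l, a k ^ q * (w k * R k ^ n) * (a l ^ q * (w l * R l ^ n)) *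
          max (R k) (R l) ^ (-e)) := by
  obtain ⟨K, hK, hpair⟩ := exists_lintegral_shell_pair_le hn he0 he
  refine ⟨K, hK, ?_⟩
  intro ι _ R w a h ha
  set A : ι → Set (EuclideanSpace ℝ (Fin (n + 1))) := fun k => shell (n + 1) (R k) (w k)
  set f : ι → EuclideanSpace ℝ (Fin (n + 1)) → ℝ≥0∞ :=
    fun k => (A k).indicator fun _ => ENNReal.ofReal (a k) ^ q
  have hAm : ∀ k, MeasurableSet (A k) := fun k => measurableSet_shell _ _ _
  have hfm : ∀ k, Measurable (f k) := fun k => measurable_const.indicator (hAm k)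
  have hg : ∀ x, ‖shellSum (n + 1) a R w x‖ₑ ^ q ≤ ∑ k, f k x := fun x => by
    rw [← sum_indicator_rpow (fun k l hkl => h.disjoint (n + 1) hkl) _ hq]
    exact ENNReal.rpow_le_rpow (enorm_shellSum_le h ha x) hq.le
  have hint : ∀ k l, ∫⁻ x, f k x * ∫⁻ y, f l y * ‖x - y‖ₑ ^ (-e) =
      ENNReal.ofReal (a k ^ q * a l ^ q) * ∫⁻ x in A k, ∫⁻ y in A l, ‖x - y‖ₑ ^ (-e) := by
    intro k l
    have hone : ∀ (k : ι) (G : EuclideanSpace ℝ (Fin (n + 1)) → ℝ≥0∞),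
        ∫⁻ x, f k x * G x = ENNReal.ofReal (a k) ^ q * ∫⁻ x in A k, G x := by
      intro k G
      rw [← lintegral_const_mul' _ _ (ENNReal.rpow_ne_top_of_nonneg hq.le ENNReal.ofReal_ne_top),
        ← lintegral_indicator (hAm k)]
      refine lintegral_congr fun x => ?_
      by_cases hx : x ∈ A k
      · simp only [f, Set.indicator_of_mem hx]
      · simp only [f, Set.indicator_of_notMem hx, zero_mul]
    simp_rw [hone]
    rw [lintegral_const_mul' _ _ (ENNReal.rpow_ne_top_of_nonneg hq.le ENNReal.ofReal_ne_top),
      ENNReal.ofReal_mul (by have := ha k; positivity), ENNReal.ofReal_rpow_of_pos (ha k),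
      ENNReal.ofReal_rpow_of_pos (ha l), mul_assoc]
  have hκ : Measurable (Function.uncurry fun x y : EuclideanSpace ℝ (Fin (n + 1)) =>
      ‖x - y‖ₑ ^ (-e)) := by
    simp only [Function.uncurry_def]
    fun_prop
  calc _ ≤ ∫⁻ x, ∫⁻ y, (∑ k, f k x) * (∑ l, f l y) * ‖x - y‖ₑ ^ (-e) := by
        refine lintegral_mono fun x => lintegral_mono fun y => ?_
        rw [div_eq_mul_inv, ← ENNReal.rpow_neg]
        exact mul_le_mul_left (mul_le_mul' (hg x) (hg y)) _
    _ = ∑ k, ∑ l, ∫⁻ x, f k x * ∫⁻ y, f l y * ‖x - y‖ₑ ^ (-e) :=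
        lintegral_lintegral_sum_mul_sum_mul volume Finset.univ hfm hκ
    _ ≤ ∑ k, ∑ l, ENNReal.ofReal (K * (a k ^ q * (w k * R k ^ n) * (a l ^ q * (w l * R l ^ n)) *
          max (R k) (R l) ^ (-e))) := by
        refine Finset.sum_le_sum fun k _ => Finset.sum_le_sum fun l _ => ?_
        have hak := ha k
        have hal := ha l
        rw [hint]
        refine (mul_le_mul_right (hpair h k l) _).trans_eq ?_
        rw [← ENNReal.ofReal_mul (by positivity)]
        congr 1; ring
    _ = _ := by
        have hnn : ∀ k l, 0 ≤ a k ^ q * (w k * R k ^ n) * (a l ^ q * (w l * R l ^ n)) *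
            max (R k) (R l) ^ (-e) := fun k l => by
          have := ha k; have := h.width_pos k; have := h.radius_pos k
          have := ha l; have := h.width_pos l; have := h.radius_pos l
          positivity
        simp_rw [Finset.mul_sum]
        rw [ENNReal.ofReal_sum_of_nonneg fun k _ => Finset.sum_nonneg fun l _ =>
          mul_nonneg hK.le (hnn k l)]
        exact Finset.sum_congr rfl fun k _ =>
          (ENNReal.ofReal_sum_of_nonneg fun l _ => mul_nonneg hK.le (hnn k l)).symm

end

/-! ### Reduction to an inequality between finite sums. -/

theorem eventually_mul_rpow_lt_rpow {A B : ℝ} (hAB : B < A) (C : ℝ) :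
    ∀ᶠ x : ℝ in Filter.atTop, C * x ^ B < x ^ A := by
  filter_upwards [(tendsto_rpow_atTop (sub_pos.2 hAB)).eventually_gt_atTop C,
    Filter.eventually_gt_atTop 0] with x hx hx0
  rw [Real.rpow_sub hx0, lt_div_iff₀ (by positivity)] at hx
  exact hx

theorem exists_sobolevSeminorm_shellSum_le {n : ℕ} (hn : 1 ≤ n) {s p : ℝ} (hs : 0 < s)
    (hs1 : s ≤ 1) (hp : 1 ≤ p) {β : ℝ} (hβ : 0 < β) :
    ∃ C : ℝ, 0 < C ∧ ∀ {ι : Type} [Fintype ι] {R w a : ι → ℝ}, SeparatedShells R w →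
      (∀ k, 0 < a k) →
      sobolevSeminorm s p (shellSum (n + 1) a R w) ^ (β * p) ≤
        ENNReal.ofReal (C * ∑ k, a k ^ p * w k ^ (1 - s * p) * R k ^ n) ^ β := by
  have hp0 : p ≠ 0 := by linarith
  have hexp : 1 / p * (β * p) = β := by field_simp
  rcases hs1.eq_or_lt with rfl | hs1
  · obtain ⟨C, hC, h⟩ := exists_lintegral_fderiv_shellSum_rpow_le hn hp
    refine ⟨C, hC, fun hS ha => ?_⟩
    rw [sobolevSeminorm, if_neg one_ne_zero, if_pos rfl, ← ENNReal.rpow_mul, hexp, one_mul]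
    exact ENNReal.rpow_le_rpow (h hS ha) hβ.le
  · obtain ⟨C, hC, h⟩ := exists_lintegral_shellSum_gagliardo_le hn hs hs1 hp
    refine ⟨C, hC, fun hS ha => ?_⟩
    rw [sobolevSeminorm, if_neg hs.ne', if_neg hs1.ne, ← ENNReal.rpow_mul, hexp]
    exact ENNReal.rpow_le_rpow (h hS ha) hβ.le

/-- The Coulomb–Sobolev inequality tested on superpositions of radial bumps. -/
theorem exists_shellSum_inequality {n : ℕ} (hn : 1 ≤ n) {s γ p q α β₁ β₂ : ℝ} (hs : 0 < s)
    (hs1 : s ≤ 1) (hγ : 1 < γ) (hp : 1 ≤ p) (hq : 1 ≤ q) (hα : 1 < α)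
    (hαd : α < ((n + 1 : ℕ) : ℝ)) (hβ₁ : 0 < β₁) (hβ₂ : 0 < β₂)
    (hC : ∃ C : ℝ≥0, ∀ g ∈ C1cRad (n + 1), eLpNorm g (ENNReal.ofReal γ) volume ≤
      C * sobolevSeminorm s p g ^ (β₁ * p) * coulombEnergy α q g ^ β₂) :
    ∃ C : ℝ, 0 < C ∧ ∀ {ι : Type} [Fintype ι] {R w a : ι → ℝ}, SeparatedShells R w →
      (∀ k, 0 < a k) →
      (∑ k, a k ^ γ * (w k * R k ^ n)) ^ (1 / γ) ≤
        C * (∑ k, a k ^ p * w k ^ (1 - s * p) * R k ^ n) ^ β₁ *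
          (∑ k, ∑ l, a k ^ q * (w k * R k ^ n) * (a l ^ q * (w l * R l ^ n)) *
            max (R k) (R l) ^ (-(((n + 1 : ℕ) : ℝ) - α))) ^ β₂ := by
  obtain ⟨C, hC⟩ := hC
  have hγ0 : 0 < γ := by linarith
  obtain ⟨c, hc, hlow⟩ := exists_le_lintegral_shellSum_rpow n γ hγ0
  obtain ⟨C₁, hC₁, hsob⟩ := exists_sobolevSeminorm_shellSum_le hn hs hs1 hp hβ₁
  obtain ⟨C₂, hC₂, hcoul⟩ := exists_lintegral_shellSum_coulomb_le hn
    (e := ((n + 1 : ℕ) : ℝ) - α) (q := q) (by linarith) (by push_cast; linarith) (by linarith)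
  refine ⟨(C + 1) * C₁ ^ β₁ * C₂ ^ β₂ / c ^ (1 / γ), by positivity, ?_⟩
  intro ι _ R w a h ha
  set Sγ := ∑ k, a k ^ γ * (w k * R k ^ n)
  set Ss := ∑ k, a k ^ p * w k ^ (1 - s * p) * R k ^ n
  set Sc := ∑ k, ∑ l, a k ^ q * (w k * R k ^ n) * (a l ^ q * (w l * R l ^ n)) *
            max (R k) (R l) ^ (-(((n + 1 : ℕ) : ℝ) - α))
  have hSγ : 0 ≤ Sγ := Finset.sum_nonneg fun k _ => by
    have := ha k; have := h.width_pos k; have := h.radius_pos k; positivity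
  have hSs : 0 ≤ Ss := Finset.sum_nonneg fun k _ => by
    have := ha k; have := h.width_pos k; have := h.radius_pos k; positivity
  have hSc : 0 ≤ Sc := Finset.sum_nonneg fun k _ => Finset.sum_nonneg fun l _ => by
    have := ha k; have := h.width_pos k; have := h.radius_pos k
    have := ha l; have := h.width_pos l; have := h.radius_pos l
    positivity
  have key : ENNReal.ofReal (c * Sγ) ^ (1 / γ) ≤
      C * ENNReal.ofReal (C₁ * Ss) ^ β₁ * ENNReal.ofReal (C₂ * Sc) ^ β₂ := by
    calc ENNReal.ofReal (c * Sγ) ^ (1 / γ)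
        ≤ (∫⁻ x, ‖shellSum (n + 1) a R w x‖ₑ ^ γ) ^ (1 / γ) :=
          ENNReal.rpow_le_rpow (hlow h ha) (by positivity)
      _ = eLpNorm (shellSum (n + 1) a R w) (ENNReal.ofReal γ) volume := by
          rw [eLpNorm_eq_lintegral_rpow_enorm_toReal (by simpa using hγ0) ENNReal.ofReal_ne_top,
            ENNReal.toReal_ofReal hγ0.le]
      _ ≤ _ := hC _ (shellSum_mem_C1cRad h (n + 1) a)
      _ ≤ _ := by
          gcongr
          · exact hsob h ha
          · exact hcoul h ha
  rw [ENNReal.ofReal_rpow_of_nonneg (by positivity) (by positivity),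
    ENNReal.ofReal_rpow_of_nonneg (by positivity) hβ₁.le,
    ENNReal.ofReal_rpow_of_nonneg (by positivity) hβ₂.le, ← ENNReal.ofReal_coe_nnreal,
    ← ENNReal.ofReal_mul C.coe_nonneg, ← ENNReal.ofReal_mul (by positivity),
    ENNReal.ofReal_le_ofReal_iff (by positivity), Real.mul_rpow hc.le hSγ,
    Real.mul_rpow hC₁.le hSs, Real.mul_rpow hC₂.le hSc] at key
  calc Sγ ^ (1 / γ) = c ^ (1 / γ) * Sγ ^ (1 / γ) / c ^ (1 / γ) := by field_simp
    _ ≤ ((C : ℝ) + 1) * (C₁ ^ β₁ * Ss ^ β₁) * (C₂ ^ β₂ * Sc ^ β₂) / c ^ (1 / γ) := by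
        refine div_le_div_of_nonneg_right (key.trans ?_) (by positivity)
        gcongr
        linarith
    _ = _ := by ring

/-! ### Geometric sequences of shells and the contradiction. -/

/-- The ratio of width to radius is `R^(y - 1) = T^(σ(y - 1)(k + 1))`. Exponents start at `k + 1`,
since at exponent `0` the width would equal the radius. The sign `σ` sends the radii to infinity or
to zero, whichever makes shells thin. -/
theorem separatedShells_geometric {σ y T : ℝ} (hσ : σ = 1 ∨ σ = -1) (hy : σ * (y - 1) < 0)
    (hT : 4 ≤ T) (hTy : T ^ (σ * (y - 1)) ≤ 1 / 4) (N : ℕ) :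
    SeparatedShells (fun k : Fin N => T ^ (σ * (k + 1))) fun k => (T ^ (σ * (k + 1))) ^ y := by
  have hT0 : 0 < T := by linarith
  refine ⟨fun k => by positivity, fun k => ?_, fun k l hkl => ?_⟩
  · have h1 : (T ^ (σ * ((k : ℝ) + 1))) ^ y =
        T ^ (σ * ((k : ℝ) + 1)) * T ^ (σ * (y - 1) * ((k : ℝ) + 1)) := by
      rw [← Real.rpow_mul hT0.le, ← Real.rpow_add hT0]
      congr 1; ring
    have h2 : T ^ (σ * (y - 1) * ((k : ℝ) + 1)) ≤ T ^ (σ * (y - 1)) :=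
      Real.rpow_le_rpow_of_exponent_le (by linarith)
        (by nlinarith [(Nat.cast_nonneg (k : ℕ) : (0 : ℝ) ≤ ((k : ℕ) : ℝ))])
    rw [h1]
    have h3 : 0 < T ^ (σ * ((k : ℝ) + 1)) := by positivity
    nlinarith
  · have hstep : ∀ u v : ℝ, u + 1 ≤ v → 4 * T ^ u ≤ T ^ v := fun u v huv => by
      calc 4 * T ^ u ≤ T ^ u * T := by
            rw [mul_comm]; gcongr
        _ = T ^ (u + 1) := by rw [Real.rpow_add hT0, Real.rpow_one]
        _ ≤ _ := Real.rpow_le_rpow_of_exponent_le (by linarith) huv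
    have hcast : ∀ {i j : Fin N}, i < j → (i : ℝ) + 1 ≤ j := fun {i j} hij => by
      exact_mod_cast Fin.lt_def.1 hij
    rcases hσ with rfl | rfl <;> rcases lt_or_gt_of_ne hkl with h | h
    · exact Or.inl (hstep _ _ (by linarith [hcast h]))
    · exact Or.inr (hstep _ _ (by linarith [hcast h]))
    · exact Or.inr (hstep _ _ (by linarith [hcast h]))
    · exact Or.inl (hstep _ _ (by linarith [hcast h]))

/-- The product is the ratio of the smaller to the larger radius, to the power `e / 2`: it equals
`1` on the diagonal and is at most `T^(-e/2)` off it. -/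
theorem rpow_mul_rpow_mul_max_rpow_le {σ e T : ℝ} (hσ : σ = 1 ∨ σ = -1) (he : 0 ≤ e)
    (hT : 1 ≤ T) {N : ℕ} (k l : Fin N) :
    (T ^ (σ * ((k : ℝ) + 1))) ^ (e / 2) * (T ^ (σ * ((l : ℝ) + 1))) ^ (e / 2) *
      max (T ^ (σ * ((k : ℝ) + 1))) (T ^ (σ * ((l : ℝ) + 1))) ^ (-e) ≤
      (if k = l then 1 else 0) + T ^ (-(e / 2)) := by
  have hT0 : 0 < T := by linarith
  have hpos : 0 < T ^ (-(e / 2)) := by positivity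
  have key : ∀ u v : ℝ, u ≤ v → (T ^ u) ^ (e / 2) * (T ^ v) ^ (e / 2) * max (T ^ u) (T ^ v) ^ (-e) =
      T ^ ((u - v) * (e / 2)) := fun u v huv => by
    rw [max_eq_right (Real.rpow_le_rpow_of_exponent_le hT huv), ← Real.rpow_mul hT0.le,
      ← Real.rpow_mul hT0.le, ← Real.rpow_mul hT0.le, ← Real.rpow_add hT0, ← Real.rpow_add hT0]
    congr 1; ring
  by_cases hkl : k = l
  · subst hkl
    rw [key _ _ le_rfl, if_pos rfl, sub_self, zero_mul, Real.rpow_zero]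
    linarith
  · have hfar : ∀ u v : ℝ, u + 1 ≤ v → (T ^ u) ^ (e / 2) * (T ^ v) ^ (e / 2) *
        max (T ^ u) (T ^ v) ^ (-e) ≤ T ^ (-(e / 2)) := fun u v huv => by
      rw [key u v (by linarith)]
      exact Real.rpow_le_rpow_of_exponent_le hT (by nlinarith)
    have hfar' : ∀ u v : ℝ, v + 1 ≤ u → (T ^ u) ^ (e / 2) * (T ^ v) ^ (e / 2) *
        max (T ^ u) (T ^ v) ^ (-e) ≤ T ^ (-(e / 2)) := fun u v huv => by
      rw [max_comm, mul_comm ((T ^ u) ^ (e / 2))]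
      exact hfar v u huv
    have hcast : ∀ {i j : Fin N}, i < j → (i : ℝ) + 1 ≤ j := fun {i j} hij => by
      exact_mod_cast Fin.lt_def.1 hij
    rw [if_neg hkl, zero_add]
    rcases hσ with rfl | rfl <;> rcases lt_or_gt_of_ne hkl with h | h
    · exact hfar _ _ (by linarith [hcast h])
    · exact hfar' _ _ (by linarith [hcast h])
    · exact hfar' _ _ (by linarith [hcast h])
    · exact hfar _ _ (by linarith [hcast h])

theorem theorem1p4 (d : ℕ) (hd : 2 ≤ d) (s γ p q α β₁ β₂ : ℝ)
    (hs₀ : 0 < s) (hs₁ : s ≤ 1) (hγ : 1 < γ) (hp : 1 ≤ p) (hq : 1 ≤ q)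
    (hα₁ : 1 < α) (hαd : α < d) (hβ₁ : 0 < β₁) (hβ₂ : 0 < β₂)
    (hbal₁ : β₁ * p + 2 * β₂ * q = 1)
    (hbal₂ : ((d : ℝ) - s * p) * β₁ + ((d : ℝ) + α) * β₂ = (d : ℝ) / γ)
    (hD : p * ((d : ℝ) + α) - 2 * q * ((d : ℝ) - s * p) ≠ 0)
    (hcond : β₁ * γ + ((d : ℝ) + α - 2) / ((d : ℝ) - 1) * β₂ * γ < 1 ∨
      (β₁ * γ + ((d : ℝ) + α - 2) / ((d : ℝ) - 1) * β₂ * γ = 1 ∧ q * (1 - s * p) ≠ p)) :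
    ¬ ∃ C : ℝ≥0, ∀ g ∈ C1cRad d,
      eLpNorm g (ENNReal.ofReal γ) volume ≤
        C * sobolevSeminorm s p g ^ (β₁ * p) * coulombEnergy α q g ^ β₂ := by
  intro hC
  obtain ⟨n, rfl⟩ : ∃ n, d = n + 1 := ⟨d - 1, by omega⟩
  have hn : 1 ≤ n := by omega
  have hn' : (0 : ℝ) < n := by exact_mod_cast hn
  have hγ0 : 0 < γ := by linarith
  obtain ⟨C, hC0, h⟩ := exists_shellSum_inequality hn hs₀ hs₁ hγ hp hq hα₁ hαd hβ₁ hβ₂ hC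
  set e : ℝ := ((n + 1 : ℕ) : ℝ) - α with he
  have he0 : 0 < e := by linarith
  have hden : ((n + 1 : ℕ) : ℝ) + α - 2 = 2 * n - e := by rw [he]; push_cast; ring
  have hden' : ((n + 1 : ℕ) : ℝ) - 1 = n := by push_cast; ring
  rw [hden, hden'] at hcond
  -- The condition compares the powers of `R` on the two sides for a single shell with unit width
  -- and height.
  have hfactor : β₁ * γ + (2 * n - e) / n * β₂ * γ = (n * β₁ + (2 * n - e) * β₂) / (n / γ) := by
    field_simp
  have hnγ : 0 < n / γ := by positivity
  rw [hfactor, div_lt_one hnγ, div_eq_one_iff_eq hnγ.ne'] at hcond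
  rcases hcond with hlt | ⟨heq, hne⟩
  · obtain ⟨R, hR, hR4⟩ := ((eventually_mul_rpow_lt_rpow hlt C).and
      (Filter.eventually_ge_atTop (4 : ℝ))).exists
    have hR0 : 0 < R := by linarith
    have hsep : SeparatedShells (fun _ : Unit => R) fun _ => 1 :=
      ⟨fun _ => one_pos, fun _ => by simpa using hR4, fun k l hkl => (hkl rfl).elim⟩
    have := h hsep (a := fun _ => 1) fun _ => one_pos
    simp only [Finset.univ_unique, Finset.sum_singleton, Real.one_rpow, one_mul, max_self] at this
    rw [← Real.rpow_natCast, ← Real.rpow_add hR0, ← Real.rpow_add hR0, ← Real.rpow_mul hR0.le,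
      ← Real.rpow_mul hR0.le, ← Real.rpow_mul hR0.le, mul_assoc, ← Real.rpow_add hR0] at this
    rw [show (n : ℝ) * (1 / γ) = n / γ by ring,
      show (n : ℝ) * β₁ + (n + n + -e) * β₂ = n * β₁ + (2 * n - e) * β₂ by ring] at this
    exact absurd hR (not_lt.2 this)
  · have hdet : p - q * (1 - s * p) ≠ 0 := fun h0 => hne (by linarith)
    have hq0 : q ≠ 0 := by linarith
    -- Normalization of the Sobolev and self-energy contributions; the witnesses come from Cramer's
    -- rule, with determinant `p - q(1 - sp)`.
    obtain ⟨x, y, h1, h2⟩ : ∃ x y : ℝ, p * x + n + (1 - s * p) * y = 0 ∧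
        q * x + y + n = e / 2 := by
      set D := p - q * (1 - s * p) with hDdef
      refine ⟨((1 - s * p) * (n - e / 2) - n) / D, (q * n - p * (n - e / 2)) / D, ?_, ?_⟩
      · field_simp
        rw [hDdef]
        ring
      · field_simp
        rw [hDdef]
        ring
    have h3 : γ * x + y + n = 0 := by
      have hγγ : γ * γ⁻¹ = 1 := mul_inv_cancel₀ hγ0.ne'
      rw [div_eq_mul_inv] at hbal₂ heq
      rw [he] at heq h2
      push_cast at hbal₂ heq h2
      -- Together with `hbal₁` and `heq`, this makes the `L^γ` equation the combination of `h1` and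
      -- `h2` with weights `β₁` and `2β₂`.
      have hb : (1 - s * p) * β₁ + 2 * β₂ = γ⁻¹ := by linear_combination hbal₂ - heq
      have h4 : x + (y + n) * γ⁻¹ = 0 := by
        linear_combination β₁ * h1 + 2 * β₂ * h2 - x * hbal₁ - y * hb - heq
      linear_combination γ * h4 - (y + n) * hγγ
    -- For `y = 1`, `h1` and `h2` read `px = -(d - sp)` and `2qx = -(d + α)`; eliminating `x` gives
    -- `𝒟 = 0`.
    have hy : y ≠ 1 := by
      rintro rfl
      apply hD
      rw [he] at h2
      push_cast at h2 ⊢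
      linear_combination 2 * p * h2 - 2 * q * h1
    obtain ⟨σ, hσ, hσy⟩ : ∃ σ : ℝ, (σ = 1 ∨ σ = -1) ∧ σ * (y - 1) < 0 := by
      rcases lt_or_gt_of_ne hy with hy | hy
      · exact ⟨1, Or.inl rfl, by linarith⟩
      · exact ⟨-1, Or.inr rfl, by linarith⟩
    -- As `e < n`, the coefficient `2n - e` in `heq` exceeds `n`.
    have hββ : β₁ + β₂ < 1 / γ := by
      have hen : e < n := by rw [he]; push_cast; linarith
      have : n * (β₁ + β₂) < n * (1 / γ) := by
        rw [mul_one_div, ← heq]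
        nlinarith
      exact lt_of_mul_lt_mul_left this hn'.le
    -- `N` is fixed before `T`: then `T^(-e/2) ≤ 1/N` bounds the total interaction by `N² · (1/N) =
    -- N`, and with the diagonal the energy sum is at most `2N`. This is the origin of `2 ^ β₂`.
    obtain ⟨N, hN, hN1⟩ := ((tendsto_natCast_atTop_atTop.eventually
      (eventually_mul_rpow_lt_rpow hββ (C * 2 ^ β₂))).and (Filter.eventually_ge_atTop 1)).exists
    have hN0 : (0 : ℝ) < N := by exact_mod_cast hN1
    have hsmall : ∀ {b ε : ℝ}, 0 < b → 0 < ε → ∀ᶠ T : ℝ in Filter.atTop, T ^ (-b) ≤ ε :=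
      fun hb hε => (tendsto_rpow_neg_atTop hb).eventually_le_const hε
    obtain ⟨T, hT4, hTy, hTe⟩ := ((Filter.eventually_ge_atTop (4 : ℝ)).and
      ((hsmall (neg_pos.2 hσy) (by norm_num : (0 : ℝ) < 1 / 4)).and
        (hsmall (half_pos he0) (one_div_pos.2 hN0)))).exists
    rw [neg_neg] at hTy
    have hsep := separatedShells_geometric hσ hσy hT4 hTy N
    have hR0 : ∀ k : Fin N, 0 < T ^ (σ * ((k : ℝ) + 1)) := fun k => by positivity
    have hineq := h (ι := Fin N) hsep (a := fun k : Fin N => (T ^ (σ * ((k : ℝ) + 1))) ^ x) fun k => by positivity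
    have hγterm : ∀ k : Fin N, ((T ^ (σ * ((k : ℝ) + 1))) ^ x) ^ γ *
        ((T ^ (σ * ((k : ℝ) + 1))) ^ y * (T ^ (σ * ((k : ℝ) + 1))) ^ n) = 1 := fun k => by
      have := hR0 k
      rw [← Real.rpow_natCast, ← Real.rpow_mul this.le, ← Real.rpow_add this, ← Real.rpow_add this,
        show x * γ + (y + n) = 0 by linarith, Real.rpow_zero]
    have hsterm : ∀ k : Fin N, ((T ^ (σ * ((k : ℝ) + 1))) ^ x) ^ p *
        ((T ^ (σ * ((k : ℝ) + 1))) ^ y) ^ (1 - s * p) * (T ^ (σ * ((k : ℝ) + 1))) ^ n = 1 := by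
      intro k
      have := hR0 k
      rw [← Real.rpow_natCast, ← Real.rpow_mul this.le, ← Real.rpow_mul this.le,
        ← Real.rpow_add this, ← Real.rpow_add this,
        show x * p + y * (1 - s * p) + n = 0 by linarith, Real.rpow_zero]
    have hcterm : ∀ k : Fin N, ((T ^ (σ * ((k : ℝ) + 1))) ^ x) ^ q *
        ((T ^ (σ * ((k : ℝ) + 1))) ^ y * (T ^ (σ * ((k : ℝ) + 1))) ^ n) =
        (T ^ (σ * ((k : ℝ) + 1))) ^ (e / 2) := fun k => by
      have := hR0 k
      rw [← Real.rpow_natCast, ← Real.rpow_mul this.le, ← Real.rpow_add this, ← Real.rpow_add this,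
        show x * q + (y + n) = e / 2 by linarith]
    simp only [hγterm, hsterm, hcterm, Finset.sum_const, Finset.card_univ, Fintype.card_fin,
      nsmul_eq_mul, mul_one] at hineq
    have hsum : ∑ k : Fin N, ∑ l : Fin N, (T ^ (σ * ((k : ℝ) + 1))) ^ (e / 2) *
        (T ^ (σ * ((l : ℝ) + 1))) ^ (e / 2) *
        max (T ^ (σ * ((k : ℝ) + 1))) (T ^ (σ * ((l : ℝ) + 1))) ^ (-e) ≤ 2 * N := by
      calc _ ≤ ∑ k : Fin N, ∑ l : Fin N, ((if k = l then 1 else 0) + 1 / (N : ℝ)) :=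
            Finset.sum_le_sum fun k _ => Finset.sum_le_sum fun l _ =>
              (rpow_mul_rpow_mul_max_rpow_le hσ he0.le (by linarith) k l).trans (by linarith)
        _ = _ := by
            simp only [Finset.sum_add_distrib, Finset.sum_ite_eq, Finset.mem_univ, if_true,
              Finset.sum_const, Finset.card_univ, Fintype.card_fin, nsmul_eq_mul]
            field_simp
            norm_num
    refine absurd hN (not_lt.2 (hineq.trans ?_))
    calc _ ≤ C * (N : ℝ) ^ β₁ * (2 * N) ^ β₂ := by
          gcongr
      _ = _ := by
          rw [Real.mul_rpow two_pos.le hN0.le, Real.rpow_add hN0]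
          ring
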